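/- Let $0<r<n\le 2r$, $J=I_r\oplus -I_{n-r}$, $[x,y]_J=y^*Jx$, and for $A\in M_n(\mathbb C)$ let $$W^J(A)=\{[Ax,x]_J:[x,x]_J=1\}\cup\{-[Ax,x]_J:[x,x]_J=-1\}$$ be its Krein space numerical range. With $A^\#=JA^*J$, $\Re^J(A)=\frac12(A+A^\#)$, $\Im^J(A)=\frac1{2i}(A-A^\#)$, let $C^J(A)$ be the indefinite Kippenhahn curve: the real affine part of the algebraic curve whose equation in homogeneous line coordinates is $\det(u\,\Re^J(A)+v\,\Im^J(A)+w I_n)=0$. Its components are the real affine parts of the curves given by the irreducible factors of this form. Let $$A=\begin{bmatrix}\alpha I_r & C\\ D&\beta I_{n-r}\end{bmatrix},\qquad \alpha,\beta\in\mathbb C,\ \alpha\ne\beta,\quad C,D\text{ not both zero},\qquad DC=z_1I_{n-r}.$$ Put $\Delta_1=(\alpha-\beta)^2+4z_1$ and $f_{1\pm}=\frac12(\alpha+\beta)\pm\frac12\sqrt{\Delta_1}$ (for either square root). Let $h_1,\dots,h_{n-r}$ be the eigenvalues of $C^*C+DD^*$, with multiplicities, labelled so that $h_1$ is the largest one, and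 let $$N_j=\Big(\tfrac12|\Delta_1|+\tfrac12|\alpha-\beta|^2-h_j\Big)^{1/2},\qquad M_j=\Big(\tfrac12|\Delta_1|-\tfrac12|\alpha-\beta|^2+h_j\Big)^{1/2}.$$ Then $W^J(A)$ is a non-degenerate hyperbolic disc (the closed region, containing the foci, bounded by a non-degenerate hyperbola) with foci $f_{1\pm}$ and non-transverse axis of length $M_1$ if and only if $$\Big|\,|\alpha-\beta|^2-2\|C^*C+DD^*\|\,\Big|<\big|(\alpha-\beta)^2+4z_1\big|,$$ where $\|\cdot\|$ is the spectral norm. In this case $N_j>0$, $M_j\ge 0$ and $N_j^2+M_j^2=|f_{1+}-f_{1-}|^2$ for all $j$, and the components of $C^J(A)$ are exactly the hyperbolas $\hat{\mathcal H}_1,\dots,\hat{\mathcal H}_{n-r}$, where $\hat{\mathcal H}_j$ has foci $f_{1\pm}$, transverse axis of length $N_j$ and non-transverse axis of length $M_j$ (if $M_j=0$, $\hat{\mathcal H}_j$ degenerates to the two points $f_{1\pm}$), together with the point $\alpha$ if $n<2r$. These hyperbolas $\hat{\mathcal H}_1,\dots,\hat{\mathcal H}_{n-r}$ are all nested: for any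 two of them, the region bounded by one contains the region bounded by the other. -/

import Mathlib

open Matrix

noncomputable section

namespace KreinRange

/-- The indefinite inner product `[x, y]_J = y^* J x` on `ℂ^ι`. -/
def indefInner {ι : Type*} [Fintype ι] (J : Matrix ι ι ℂ) (x y : ι → ℂ) : ℂ :=
  star y ⬝ᵥ (J *ᵥ x)

/-- `W_+^J(A) = { [Ax, x]_J : [x, x]_J = 1 }`. -/
def numRangePlus {ι : Type*} [Fintype ι] (J A : Matrix ι ι ℂ) : Set ℂ :=
  {w | ∃ x : ι → ℂ, indefInner J x x = 1 ∧ w = indefInner J (A *ᵥ x) x}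

/-- `W_-^J(A) = { [Ax, x]_J : [x, x]_J = -1 }`. -/
def numRangeMinus {ι : Type*} [Fintype ι] (J A : Matrix ι ι ℂ) : Set ℂ :=
  {w | ∃ x : ι → ℂ, indefInner J x x = -1 ∧ w = indefInner J (A *ᵥ x) x}

/-- The Krein space numerical range `W^J(A) = -W_-^J(A) ∪ W_+^J(A)`. -/
def numRange {ι : Type*} [Fintype ι] (J A : Matrix ι ι ℂ) : Set ℂ :=
  {w | -w ∈ numRangeMinus J A} ∪ numRangePlus J A

/-- The inertia matrix `J = I_r ⊕ -I_s`. -/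
def inertia (r s : ℕ) : Matrix (Fin r ⊕ Fin s) (Fin r ⊕ Fin s) ℂ :=
  fromBlocks 1 0 0 (-1)

/-- The block matrix with diagonal blocks `α I_r`, `β I_s` and off-diagonal blocks `C`, `D`. -/
def blockMatrix {r s : ℕ} (α β : ℂ) (C : Matrix (Fin r) (Fin s) ℂ)
    (D : Matrix (Fin s) (Fin r) ℂ) : Matrix (Fin r ⊕ Fin s) (Fin r ⊕ Fin s) ℂ :=
  fromBlocks (α • (1 : Matrix (Fin r) (Fin r) ℂ)) C D (β • (1 : Matrix (Fin s) (Fin s) ℂ))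

/-- The `J`-adjoint `A^# = J A^* J` (for an inertia matrix `J`). -/
def adjointJ {ι : Type*} [Fintype ι] (J A : Matrix ι ι ℂ) : Matrix ι ι ℂ :=
  J * Aᴴ * J

/-- `Re^J(A) = (A + A^#) / 2`. -/
def rePart {ι : Type*} [Fintype ι] (J A : Matrix ι ι ℂ) : Matrix ι ι ℂ :=
  (1 / 2 : ℂ) • (A + adjointJ J A)

/-- `Im^J(A) = (A - A^#) / (2i)`. -/
def imPart {ι : Type*} [Fintype ι] (J A : Matrix ι ι ℂ) : Matrix ι ι ℂ :=
  (1 / (2 * Complex.I)) • (A - adjointJ J A)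

/-- The ternary form `det (u Re^J(A) + v Im^J(A) + w I)`, in the variables
`u = X 0`, `v = X 1`, `w = X 2`. -/
def kippenhahnPoly {ι : Type*} [Fintype ι] [DecidableEq ι] (J A : Matrix ι ι ℂ) :
    MvPolynomial (Fin 3) ℂ :=
  Matrix.det
    ((MvPolynomial.X 0 : MvPolynomial (Fin 3) ℂ) • (rePart J A).map MvPolynomial.C
      + (MvPolynomial.X 1 : MvPolynomial (Fin 3) ℂ) • (imPart J A).map MvPolynomial.C
      + (MvPolynomial.X 2 : MvPolynomial (Fin 3) ℂ) • 1)

/-- The cone in `ℂ³` over the points of contact `∇q(ℓ)` of the lines `ℓ = (u, v, w)` (that is,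
`u x + v y + w = 0`) with `q(ℓ) = 0`. -/
def contactCone (q : MvPolynomial (Fin 3) ℂ) : Set (Fin 3 → ℂ) :=
  {P | ∃ (t : ℂ) (l : Fin 3 → ℂ), MvPolynomial.eval l q = 0 ∧
    P = fun i => t * MvPolynomial.eval l (MvPolynomial.pderiv i q)}

/-- The affine cone over the projective plane curve whose equation in homogeneous line coordinates
is `q = 0`, for irreducible `q`: the Zariski closure of the set of points of contact. -/
def dualCurve (q : MvPolynomial (Fin 3) ℂ) : Set (Fin 3 → ℂ) :=
  MvPolynomial.zeroLocus ℂ (MvPolynomial.vanishingIdeal ℂ (contactCone q))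

/-- The real affine points `(x : y : 1)` of a plane projective curve, as the set of the
`x + i y` in `ℂ`. -/
def realAffinePart (S : Set (Fin 3 → ℂ)) : Set ℂ :=
  {p | ![(p.re : ℂ), (p.im : ℂ), 1] ∈ S}

/-- The components of the indefinite Kippenhahn curve `C^J(A)`: the real affine parts of the curves
given in line coordinates by the irreducible factors of `det (u Re^J(A) + v Im^J(A) + w I)`. -/
def kippenhahnComponents {ι : Type*} [Fintype ι] [DecidableEq ι] (J A : Matrix ι ι ℂ) :
    Set (Set ℂ) :=
  {K | ∃ q : MvPolynomial (Fin 3) ℂ, Irreducible q ∧ q ∣ kippenhahnPoly J A ∧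
    K = realAffinePart (dualCurve q)}

/-- The hyperbola with foci `F₁`, `F₂` and transverse axis of length `N`
(non-degenerate when `0 < N < |F₁ - F₂|`). -/
def hyperbola (F₁ F₂ : ℂ) (N : ℝ) : Set ℂ :=
  {w | |‖w - F₁‖ - ‖w - F₂‖| = N}

/-- The closed region bounded by that hyperbola which contains the foci. -/
def hyperbolicDisc (F₁ F₂ : ℂ) (N : ℝ) : Set ℂ :=
  {w | N ≤ |‖w - F₁‖ - ‖w - F₂‖|}

/-- `S` is the hyperbolic disc bounded by a non-degenerate hyperbola with foci `F₁`, `F₂` and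
non-transverse axis of length `M`. The transverse axis then has length `N`, `N² + M² = |F₁ - F₂|²`. -/
def IsNondegenerateHyperbolicDisc (S : Set ℂ) (F₁ F₂ : ℂ) (M : ℝ) : Prop :=
  0 < M ∧ ∃ N : ℝ, 0 < N ∧ N ^ 2 + M ^ 2 = ‖F₁ - F₂‖ ^ 2 ∧ S = hyperbolicDisc F₁ F₂ N

/-- Two hyperbolas, with foci `F₁, F₂` and `G₁, G₂` and transverse axes of lengths `N` and `N'`, are
nested: the region bounded by one of them contains the region bounded by the other. -/
def Nested (F₁ F₂ : ℂ) (N : ℝ) (G₁ G₂ : ℂ) (N' : ℝ) : Prop :=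
  hyperbolicDisc F₁ F₂ N ⊆ hyperbolicDisc G₁ G₂ N' ∨
    hyperbolicDisc G₁ G₂ N' ⊆ hyperbolicDisc F₁ F₂ N

/-- Length of the transverse axis,
`N_j = (|Δ|/2 + |α-β|²/2 - h_j)^(1/2)` with `Δ = (α-β)² + 4z`. -/
def transverseAxis (α β z : ℂ) (h : ℝ) : ℝ :=
  Real.sqrt (‖(α - β) ^ 2 + 4 * z‖ / 2 + ‖α - β‖ ^ 2 / 2 - h)

/-- Length of the non-transverse axis,
`M_j = (|Δ|/2 - |α-β|²/2 + h_j)^(1/2)` with `Δ = (α-β)² + 4z`. -/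
def nonTransverseAxis (α β z : ℂ) (h : ℝ) : ℝ :=
  Real.sqrt (‖(α - β) ^ 2 + 4 * z‖ / 2 - ‖α - β‖ ^ 2 / 2 + h)

/-- The spectral norm of a complex matrix: the operator norm for the Euclidean norm. -/
def euclideanOpNorm {s : ℕ} (X : Matrix (Fin s) (Fin s) ℂ) : ℝ :=
  ‖Matrix.toEuclideanCLM (n := Fin s) (𝕜 := ℂ) X‖

end KreinRange

end

/-!
Write `α = g + d`, `β = g - d`, and `e ^ 2 = d ^ 2 + z₁`, so that the foci are `g ± e`. For a vector
`x = (p, q)` the value `[Ax, x]_J` is `g [x, x]_J + d (‖p‖² + ‖q‖²) + (p^* C q - q^* D p)`. Since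
`D C` is scalar, for fixed `q` and `‖p‖` the support function of the last term depends on `q` only
through `‖q‖` and `q^* (C^* C + D D^*) q` (`normSqVec_supportVec`), and its square is
`4 ((ζ·d)² - b(ζ))` at the top eigenvalue and unit `p`, `q`, with `b(ζ) = (ζ·e)² - m ‖ζ‖² / 4` and
`m = M₁²` (`support_eq`). Hence the numerical range is, up to translation, the image of the
two-sheeted hyperboloid `c² - ‖p‖² = 1` under a real-linear map to the plane (`sheetMap`). The form
`b` is the push-forward of `c² - ‖p‖²` to the dual of the plane. When it is indefinite, that is under
the inequality of the theorem, the image is the region bounded by the conic dual to `b`, which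
is the hyperbola with foci `g ± e` and axes `√n`, `√m`.

* One inclusion compares support functions: `b(ζ) ≤ (ζ·Z)²` for every `ζ` and every point `Z` of the
  range, and the determinant of this semidefinite form is the equation of the conic
  (`le_conicForm_of_mem_numRange`).
* For the other, the critical point of `c² - ‖p‖²` on the fibre over `Z` has value at least `1`, and
  the value is brought down to `1` along a kernel vector of the map, on which `c² - ‖p‖²` is negative
  (`mem_numRange_of_le_conicForm`).

Conversely, the lengths of the axes of a non-degenerate hyperbolic disc are positive, and
the inequality merely says that `m` and `n` are.

For the Kippenhahn curve, the product of the off-diagonal blocks of `u Re^J(A) + v Im^J(A) + w I` is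
a scalar matrix minus a multiple of `C^* C + D D^*`, so the determinant is a power of the linear form
of `α` times one quadratic form for each eigenvalue (`kippenhahnPoly_eq`, `conicPoly_eq`). Such a form
is the product of the linear forms of the two foci plus `M_j² (u² + v²) / 4`. For `M_j > 0` it has
rank three, so it is irreducible, and its points of contact form the dual conic, which is already
closed (`realAffinePart_dualCurve_conicPoly`); for `M_j = 0` it splits into the two foci.
-/

/-! ### Hyperbolas in Cartesian coordinates -/

namespace KreinRange

open Complex

/-- The quadratic expression whose comparison with `m n` describes the hyperbola with foci
`g ± e` and axes `√n`, `√m`, where `n + m = 4 ‖e‖²`. -/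
def conicForm (e : ℂ) (m : ℝ) (z : ℂ) : ℝ :=
  4 * m * (z.re ^ 2 + z.im ^ 2) - 16 * (e.re * z.im - e.im * z.re) ^ 2

lemma norm_sq_eq_re_im (z : ℂ) : ‖z‖ ^ 2 = z.re ^ 2 + z.im ^ 2 := by
  rw [← Complex.normSq_eq_norm_sq, Complex.normSq_apply]; ring

/-- Squaring twice removes the norms from the focal equation. -/
lemma focal_identity (g e w : ℂ) {n m : ℝ} (hnm : n + m = 4 * ‖e‖ ^ 2) :
    (‖w - (g + e)‖ - ‖w - (g - e)‖) ^ 2 =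
        2 * ‖w - g‖ ^ 2 + 2 * ‖e‖ ^ 2 - 2 * (‖w - (g + e)‖ * ‖w - (g - e)‖) ∧
      (2 * ‖w - g‖ ^ 2 + 2 * ‖e‖ ^ 2 - n) ^ 2 - (2 * (‖w - (g + e)‖ * ‖w - (g - e)‖)) ^ 2 =
        conicForm e m (w - g) - n * m := by
  have h1 := norm_sq_eq_re_im (w - (g + e))
  have h2 := norm_sq_eq_re_im (w - (g - e))
  have h3 := norm_sq_eq_re_im (w - g)
  have h4 := norm_sq_eq_re_im e
  simp only [sub_re, sub_im, add_re, add_im] at h1 h2 h3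
  have hm : m = 4 * ‖e‖ ^ 2 - n := by linarith
  constructor
  · rw [sub_sq, h1, h2, h3, h4]; ring
  · rw [mul_pow, mul_pow, h1, h2, h3, hm, conicForm, h4]
    simp only [sub_re, sub_im]
    ring

lemma focal_bound_nonneg {g e w : ℂ} {n m : ℝ} (hm : 0 < m) (hnm : n + m = 4 * ‖e‖ ^ 2)
    (h : n * m ≤ conicForm e m (w - g)) : 0 ≤ 2 * ‖w - g‖ ^ 2 + 2 * ‖e‖ ^ 2 - n := by
  have h3 := norm_sq_eq_re_im (w - g)
  have : n * m ≤ 4 * ‖w - g‖ ^ 2 * m := by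
    rw [h3]
    unfold conicForm at h
    nlinarith [sq_nonneg (e.re * (w - g).im - e.im * (w - g).re)]
  have := le_of_mul_le_mul_right this hm
  linarith

lemma mem_hyperbolicDisc_iff (g e w : ℂ) {n m : ℝ} (hm : 0 < m)
    (hnm : n + m = 4 * ‖e‖ ^ 2) :
    w ∈ hyperbolicDisc (g + e) (g - e) (√n) ↔ n * m ≤ conicForm e m (w - g) := by
  obtain ⟨h1, h2⟩ := focal_identity g e w hnm
  have hp : 0 ≤ 2 * (‖w - (g + e)‖ * ‖w - (g - e)‖) := by positivity
  rw [hyperbolicDisc, Set.mem_ofPred_eq, Real.sqrt_le_left (abs_nonneg _), sq_abs, h1]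
  constructor
  · intro h
    nlinarith
  · intro h
    have := abs_le_of_sq_le_sq' (a := 2 * (‖w - (g + e)‖ * ‖w - (g - e)‖)) (by linarith)
      (focal_bound_nonneg hm hnm h)
    linarith [this.2]

lemma mem_hyperbola_iff (g e w : ℂ) {n m : ℝ} (hn : 0 < n) (hm : 0 < m)
    (hnm : n + m = 4 * ‖e‖ ^ 2) :
    w ∈ hyperbola (g + e) (g - e) (√n) ↔ conicForm e m (w - g) = n * m := by
  obtain ⟨h1, h2⟩ := focal_identity g e w hnm
  have hp : 0 ≤ 2 * (‖w - (g + e)‖ * ‖w - (g - e)‖) := by positivity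
  have h0 : w ∈ hyperbola (g + e) (g - e) (√n) ↔
      2 * ‖w - g‖ ^ 2 + 2 * ‖e‖ ^ 2 - 2 * (‖w - (g + e)‖ * ‖w - (g - e)‖) = n := by
    rw [hyperbola, Set.mem_ofPred_eq, ← h1, ← sq_abs]
    constructor
    · intro h; rw [h, Real.sq_sqrt hn.le]
    · intro h; rw [← h, Real.sqrt_sq (abs_nonneg _)]
  rw [h0]
  constructor
  · intro h
    have : 2 * ‖w - g‖ ^ 2 + 2 * ‖e‖ ^ 2 - n = 2 * (‖w - (g + e)‖ * ‖w - (g - e)‖) := by linarith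
    rw [this, sub_self] at h2
    linarith
  · intro h
    have := (sq_eq_sq₀ (focal_bound_nonneg hm hnm h.ge) hp).1 (by linarith)
    linarith

end KreinRange

/-! ### Lines, conics and their dual curves -/

namespace KreinRange

open MvPolynomial

/-- The linear form in line coordinates that vanishes on the lines through the point `f`. -/
noncomputable def pointForm (f : ℂ) : MvPolynomial (Fin 3) ℂ :=
  C (f.re : ℂ) * X 0 + C (f.im : ℂ) * X 1 + X 2

/-- The quadratic form in line coordinates of the conic with foci `g ± e` and squared
non-transverse axis `m`. -/
noncomputable def conicPoly (g e : ℂ) (m : ℝ) : MvPolynomial (Fin 3) ℂ :=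
  pointForm (g + e) * pointForm (g - e) + C ((m : ℂ) / 4) * (X 0 ^ 2 + X 1 ^ 2)

/-- The point conic dual to `conicPoly g e m`, with `n m / 16` the discriminant up to sign. -/
noncomputable def dualConicPoly (g e : ℂ) (n m : ℝ) : MvPolynomial (Fin 3) ℂ :=
  C ((m : ℂ) / 4) * ((X 0 - C (g.re : ℂ) * X 2) ^ 2 + (X 1 - C (g.im : ℂ) * X 2) ^ 2)
    - (C (e.re : ℂ) * (X 1 - C (g.im : ℂ) * X 2) - C (e.im : ℂ) * (X 0 - C (g.re : ℂ) * X 2)) ^ 2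
    - C ((n * m : ℂ) / 16) * X 2 ^ 2

lemma eval_pointForm (f : ℂ) (l : Fin 3 → ℂ) :
    eval l (pointForm f) = f.re * l 0 + f.im * l 1 + l 2 := by
  simp [pointForm]

lemma eval_pderiv_pointForm (f : ℂ) (l : Fin 3 → ℂ) (i : Fin 3) :
    eval l (pderiv i (pointForm f)) = ![(f.re : ℂ), f.im, 1] i := by
  fin_cases i <;> simp [pointForm, pderiv_X]

lemma contactCone_pointForm (f : ℂ) :
    contactCone (pointForm f) = {P | ∃ t : ℂ, P = fun i => t * ![(f.re : ℂ), f.im, 1] i} := by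
  ext P
  simp only [contactCone, Set.mem_ofPred_eq, eval_pderiv_pointForm]
  constructor
  · rintro ⟨t, -, -, h⟩
    exact ⟨t, h⟩
  · rintro ⟨t, h⟩
    exact ⟨t, 0, by rw [eval_pointForm]; simp, h⟩

lemma contactCone_subset_dualCurve (q : MvPolynomial (Fin 3) ℂ) :
    contactCone q ⊆ dualCurve q :=
  zeroLocus_vanishingIdeal_le _

lemma eval_eq_zero_of_mem_dualCurve {q F : MvPolynomial (Fin 3) ℂ}
    (hF : ∀ P ∈ contactCone q, eval P F = 0) {P : Fin 3 → ℂ} (hP : P ∈ dualCurve q) :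
    eval P F = 0 := by
  have : F ∈ vanishingIdeal ℂ (contactCone q) := by
    rw [mem_vanishingIdeal_iff]
    intro x hx
    simpa [aeval_eq_eval] using hF x hx
  simpa [aeval_eq_eval] using (mem_zeroLocus_iff.1 hP) F this

lemma realAffinePart_dualCurve_pointForm (f : ℂ) :
    realAffinePart (dualCurve (pointForm f)) = {f} := by
  ext p
  rw [realAffinePart, Set.mem_ofPred_eq, Set.mem_singleton_iff]
  constructor
  · intro h
    have h0 := eval_eq_zero_of_mem_dualCurve (F := X 0 - C (f.re : ℂ) * X 2)
      (by rw [contactCone_pointForm]; rintro P ⟨t, rfl⟩; simp; ring) h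
    have h1 := eval_eq_zero_of_mem_dualCurve (F := X 1 - C (f.im : ℂ) * X 2)
      (by rw [contactCone_pointForm]; rintro P ⟨t, rfl⟩; simp; ring) h
    simp [sub_eq_zero] at h0 h1
    exact Complex.ext h0 h1
  · rintro rfl
    refine contactCone_subset_dualCurve _ ?_
    rw [contactCone_pointForm]
    exact ⟨1, by simp⟩

lemma eval_conicPoly (g e : ℂ) (m : ℝ) (l : Fin 3 → ℂ) :
    eval l (conicPoly g e m) = (g.re * l 0 + g.im * l 1 + l 2) ^ 2 - (e.re * l 0 + e.im * l 1) ^ 2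
      + m / 4 * (l 0 ^ 2 + l 1 ^ 2) := by
  simp [conicPoly, eval_pointForm]
  ring

lemma eval_pderiv_conicPoly (g e : ℂ) (m : ℝ) (l : Fin 3 → ℂ) (i : Fin 3) :
    eval l (pderiv i (conicPoly g e m)) =
      ![2 * (g.re * l 0 + g.im * l 1 + l 2) * g.re - 2 * (e.re * l 0 + e.im * l 1) * e.re
          + m / 2 * l 0,
        2 * (g.re * l 0 + g.im * l 1 + l 2) * g.im - 2 * (e.re * l 0 + e.im * l 1) * e.im
          + m / 2 * l 1,
        2 * (g.re * l 0 + g.im * l 1 + l 2)] i := by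
  simp only [conicPoly, map_add, Derivation.leibniz, smul_eq_mul, map_mul, eval_pderiv_pointForm,
    eval_pointForm]
  fin_cases i <;> simp [pderiv_X, Derivation.leibniz_pow] <;> ring

lemma eval_dualConicPoly (g e : ℂ) (n m : ℝ) (P : Fin 3 → ℂ) :
    eval P (dualConicPoly g e n m) =
      m / 4 * ((P 0 - g.re * P 2) ^ 2 + (P 1 - g.im * P 2) ^ 2)
      - (e.re * (P 1 - g.im * P 2) - e.im * (P 0 - g.re * P 2)) ^ 2
      - n * m / 16 * P 2 ^ 2 := by
  simp [dualConicPoly]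

lemma cast_axes {e : ℂ} {n m : ℝ} (hnm : n + m = 4 * ‖e‖ ^ 2) :
    (n : ℂ) = 4 * (e.re ^ 2 + e.im ^ 2) - m := by
  rw [norm_sq_eq_re_im] at hnm
  have : n = 4 * (e.re ^ 2 + e.im ^ 2) - m := by linarith
  exact_mod_cast this

lemma eval_dualConicPoly_of_mem_contactCone {g e : ℂ} {n m : ℝ} (hnm : n + m = 4 * ‖e‖ ^ 2)
    {P : Fin 3 → ℂ} (hP : P ∈ contactCone (conicPoly g e m)) :
    eval P (dualConicPoly g e n m) = 0 := by
  obtain ⟨t, l, hl, rfl⟩ := hP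
  rw [eval_conicPoly] at hl
  rw [eval_dualConicPoly, cast_axes hnm]
  simp only [eval_pderiv_conicPoly, cons_val_zero, cons_val_one, cons_val]
  linear_combination (4 * t ^ 2 * (m / 4 * (m / 4 - e.re ^ 2 - e.im ^ 2))) * hl

lemma mem_contactCone_of_eval_dualConicPoly {g e : ℂ} {n m : ℝ} (hn : 0 < n) (hm : 0 < m)
    (hnm : n + m = 4 * ‖e‖ ^ 2) {P : Fin 3 → ℂ} (hP : eval P (dualConicPoly g e n m) = 0) :
    P ∈ contactCone (conicPoly g e m) := by
  have hn0 : (n : ℂ) ≠ 0 := by exact_mod_cast hn.ne'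
  have hm0 : (m : ℂ) ≠ 0 := by exact_mod_cast hm.ne'
  have hn' := cast_axes hnm
  rw [eval_dualConicPoly] at hP
  -- the line is found by applying the adjugate of the matrix of `conicPoly` to `P`
  set x := P 0 - g.re * P 2 with hx
  set y := P 1 - g.im * P 2 with hy
  set u : ℂ := (m / 4 - e.im ^ 2) * x + e.re * e.im * y with hu
  set v : ℂ := e.re * e.im * x + (m / 4 - e.re ^ 2) * y with hv
  refine ⟨-8 / (n * m), ![u, v, -(n * m / 16) * P 2 - g.re * u - g.im * v], ?_, ?_⟩
  · rw [eval_conicPoly]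
    simp only [cons_val_zero, cons_val_one, cons_val]
    rw [hu, hv]
    rw [hn'] at hP ⊢
    linear_combination (-(4 * (e.re ^ 2 + e.im ^ 2) - m) * m / 16) * hP
  · funext i
    rw [eval_pderiv_conicPoly]
    fin_cases i <;> simp only [cons_val_zero, cons_val_one, cons_val, Fin.zero_eta, Fin.mk_one,
      Fin.reduceFinMk] <;> field_simp
    · rw [hu, hv, hn', hx, hy]; ring
    · rw [hu, hv, hn', hx, hy]; ring
    · ring

lemma realAffinePart_dualCurve_conicPoly (g e : ℂ) {n m : ℝ} (hn : 0 < n) (hm : 0 < m)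
    (hnm : n + m = 4 * ‖e‖ ^ 2) :
    realAffinePart (dualCurve (conicPoly g e m)) = hyperbola (g + e) (g - e) (√n) := by
  ext p
  have key : eval ![(p.re : ℂ), (p.im : ℂ), 1] (dualConicPoly g e n m) =
      (((conicForm e m (p - g) - n * m) / 16 : ℝ) : ℂ) := by
    rw [eval_dualConicPoly]
    simp [conicForm]
    ring
  rw [mem_hyperbola_iff g e p hn hm hnm, realAffinePart, Set.mem_ofPred_eq]
  have : conicForm e m (p - g) = n * m ↔
      eval ![(p.re : ℂ), (p.im : ℂ), 1] (dualConicPoly g e n m) = 0 := by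
    rw [key, Complex.ofReal_eq_zero, div_eq_zero_iff, sub_eq_zero]
    norm_num
  rw [this]
  exact ⟨eval_eq_zero_of_mem_dualCurve fun P hP => eval_dualConicPoly_of_mem_contactCone hnm hP,
    fun h => contactCone_subset_dualCurve _ (mem_contactCone_of_eval_dualConicPoly hn hm hnm h)⟩

lemma contactCone_C_mul (q : MvPolynomial (Fin 3) ℂ) {c : ℂ} (hc : c ≠ 0) :
    contactCone (C c * q) = contactCone q := by
  ext P
  constructor
  · rintro ⟨t, l, hl, rfl⟩
    refine ⟨t * c, l, by simpa [hc] using hl, ?_⟩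
    funext i
    simp [mul_assoc]
  · rintro ⟨t, l, hl, rfl⟩
    refine ⟨t / c, l, by simp [hl], ?_⟩
    funext i
    simp
    field_simp

lemma dualCurve_eq_of_associated {p q : MvPolynomial (Fin 3) ℂ} (h : Associated p q) :
    dualCurve p = dualCurve q := by
  obtain ⟨u, rfl⟩ := h
  obtain ⟨c, hc, hu⟩ :=
    (isUnit_iff_eq_C_of_isReduced (P := (u : MvPolynomial (Fin 3) ℂ))).1 u.isUnit
  rw [dualCurve, dualCurve, hu, mul_comm, contactCone_C_mul _ hc.ne_zero]

/-! ### Irreducibility -/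

lemma isHomogeneous_pointForm (f : ℂ) : (pointForm f).IsHomogeneous 1 :=
  ((isHomogeneous_C_mul_X _ _).add (isHomogeneous_C_mul_X _ _)).add (isHomogeneous_X _ _)

lemma irreducible_pointForm (f : ℂ) : Irreducible (pointForm f) := by
  have h2 : coeff (Finsupp.single 2 1) (pointForm f) = 1 := by
    simp [pointForm, coeff_X, Finsupp.single_left_inj]
  have hne : pointForm f ≠ 0 := by
    intro h
    rw [h] at h2
    simp at h2
  refine irreducible_of_totalDegree_eq_one ((isHomogeneous_pointForm f).totalDegree hne)
    fun x hx => ?_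
  have := hx (Finsupp.single 2 1)
  rw [h2] at this
  exact isUnit_of_dvd_one this

lemma exists_affine_of_totalDegree_eq_one {σ R : Type*} [Fintype σ] [CommSemiring R]
    {p : MvPolynomial σ R} (hp : p.totalDegree = 1) :
    ∃ (c : R) (a : σ → R), ∀ l, eval l p = c + ∑ i, a i * l i := by
  have h1 : homogeneousComponent 1 p ∈ Submodule.span R (Set.range (X : σ → MvPolynomial σ R)) := by
    rw [← homogeneousSubmodule_one_eq_span_X]
    exact homogeneousComponent_mem _ _
  obtain ⟨a, ha⟩ := (Submodule.mem_span_range_iff_exists_fun R).1 h1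
  refine ⟨coeff 0 p, a, fun l => ?_⟩
  have := sum_homogeneousComponent p
  rw [hp, Finset.sum_range_succ, Finset.sum_range_one, homogeneousComponent_zero, ← ha] at this
  conv_lhs => rw [← this]
  simp [smul_eval]

/-- A product of two linear forms in three variables has rank at most two. -/
lemma det_eq_zero_of_quadratic_eq_mul {Q : Matrix (Fin 3) (Fin 3) ℂ} (hsymm : Q.IsSymm)
    {a b : Fin 3 → ℂ} (h : ∀ l, l ⬝ᵥ Q *ᵥ l = (∑ i, a i * l i) * ∑ i, b i * l i) : Q.det = 0 := by
  have h0 := h ![1, 0, 0]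
  have h1 := h ![0, 1, 0]
  have h2 := h ![0, 0, 1]
  have h01 := h ![1, 1, 0]
  have h02 := h ![1, 0, 1]
  have h12 := h ![0, 1, 1]
  simp [Fin.sum_univ_three, dotProduct, mulVec] at h0 h1 h2 h01 h02 h12
  have s10 := hsymm.apply 0 1
  have s20 := hsymm.apply 0 2
  have s21 := hsymm.apply 1 2
  rw [s10] at h01
  rw [s20] at h02
  rw [s21] at h12
  have e01 : Q 0 1 = (a 0 * b 1 + a 1 * b 0) / 2 := by linear_combination (h01 - h0 - h1) / 2
  have e02 : Q 0 2 = (a 0 * b 2 + a 2 * b 0) / 2 := by linear_combination (h02 - h0 - h2) / 2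
  have e12 : Q 1 2 = (a 1 * b 2 + a 2 * b 1) / 2 := by linear_combination (h12 - h1 - h2) / 2
  rw [det_fin_three, s10, s20, s21, h0, h1, h2, e01, e02, e12]
  ring

lemma irreducible_of_eval_eq_quadratic {q : MvPolynomial (Fin 3) ℂ} (hhom : q.IsHomogeneous 2)
    {Q : Matrix (Fin 3) (Fin 3) ℂ} (hdet : Q.det ≠ 0) (hsymm : Q.IsSymm)
    (hQ : ∀ l, eval l q = l ⬝ᵥ Q *ᵥ l) : Irreducible q := by
  have hq0 : q ≠ 0 := by
    rintro rfl
    exact hdet (det_eq_zero_of_quadratic_eq_mul hsymm (a := 0) (b := 0) fun l => by simp [← hQ])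
  have hdeg := hhom.totalDegree hq0
  refine ⟨fun hu => ?_, fun f g hfg => ?_⟩
  · rw [(isUnit_iff_totalDegree_of_isReduced.1 hu).2] at hdeg
    simp at hdeg
  · subst hfg
    have hf0 := left_ne_zero_of_mul hq0
    have hg0 := right_ne_zero_of_mul hq0
    rw [totalDegree_mul_of_isDomain hf0 hg0] at hdeg
    have isUnit_of_degree {p : MvPolynomial (Fin 3) ℂ} (hp : p ≠ 0) (hd : p.totalDegree = 0) :
        IsUnit p := by
      obtain ⟨c, rfl⟩ : ∃ c, p = C c := ⟨_, totalDegree_eq_zero_iff_eq_C.1 hd⟩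
      exact (IsUnit.mk0 _ fun hc => hp (by rw [hc, C_0])).map C
    by_contra! hcon
    have hf1 : f.totalDegree ≠ 0 := fun h => hcon.1 (isUnit_of_degree hf0 h)
    have hg1 : g.totalDegree ≠ 0 := fun h => hcon.2 (isUnit_of_degree hg0 h)
    obtain ⟨c, a, ha⟩ := exists_affine_of_totalDegree_eq_one (p := f) (by omega)
    obtain ⟨d, b, hb⟩ := exists_affine_of_totalDegree_eq_one (p := g) (by omega)
    refine hdet (det_eq_zero_of_quadratic_eq_mul hsymm (a := a) (b := b) fun l => ?_)
    -- comparing the values at `0`, `l` and `-l` removes the constant terms of the factors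
    have h0 := hQ 0
    have h1 := hQ l
    have h2 := hQ (-l)
    rw [map_mul, ha, hb] at h0 h1 h2
    simp only [Pi.zero_apply, Pi.neg_apply, mul_zero, mul_neg, Finset.sum_const_zero,
      Finset.sum_neg_distrib, mulVec_neg, dotProduct_neg, neg_dotProduct, neg_neg,
      zero_dotProduct, add_zero] at h0 h1 h2
    linear_combination h0 - (h1 + h2) / 2

lemma irreducible_conicPoly (g e : ℂ) {n m : ℝ} (hn : 0 < n) (hm : 0 < m)
    (hnm : n + m = 4 * ‖e‖ ^ 2) : Irreducible (conicPoly g e m) := by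
  have hhom : (conicPoly g e m).IsHomogeneous 2 :=
    ((isHomogeneous_pointForm _).mul (isHomogeneous_pointForm _)).add
      (((isHomogeneous_X_pow _ _).add (isHomogeneous_X_pow _ _)).C_mul _)
  refine irreducible_of_eval_eq_quadratic hhom
    (Q := !![(g.re ^ 2 - e.re ^ 2 + m / 4 : ℂ), g.re * g.im - e.re * e.im, g.re;
      g.re * g.im - e.re * e.im, g.im ^ 2 - e.im ^ 2 + m / 4, g.im; g.re, g.im, 1]) ?_ ?_ ?_
  · have hn0 : (n : ℂ) ≠ 0 := by exact_mod_cast hn.ne'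
    have hm0 : (m : ℂ) ≠ 0 := by exact_mod_cast hm.ne'
    have : -(n * m / 16 : ℂ) ≠ 0 := by simp [hn0, hm0]
    convert this using 1
    rw [cast_axes hnm]
    simp [det_fin_three]
    ring
  · ext i j
    fin_cases i <;> fin_cases j <;> rfl
  · intro l
    rw [eval_conicPoly]
    simp [dotProduct, mulVec, Fin.sum_univ_three]
    ring

end KreinRange

/-! ### The determinantal form -/

namespace KreinRange

open MvPolynomial

/-- A block determinant with scalar diagonal blocks, over a domain. -/
lemma det_fromBlocks_smul_one {R : Type*} [CommRing R] [IsDomain R] {r s : ℕ} (hsr : s ≤ r)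
    {a : R} (ha : a ≠ 0) (b : R) (K : Matrix (Fin r) (Fin s) R) (L : Matrix (Fin s) (Fin r) R) :
    (fromBlocks (a • 1) K L (b • 1)).det = a ^ (r - s) * ((a * b) • 1 - L * K).det := by
  have key : fromBlocks (a • 1) K L (b • 1) * fromBlocks 1 (-K) 0 (a • 1) =
      fromBlocks (a • 1) 0 L ((a * b) • 1 - L * K) := by
    rw [fromBlocks_multiply]
    congr 1
    · simp
    · simp
    · simp
    · simp [smul_smul]
      abel
  have hdet := congrArg det key
  rw [det_mul, det_fromBlocks_zero₂₁, det_fromBlocks_zero₁₂, det_smul, det_smul, det_one, det_one]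
    at hdet
  simp only [Fintype.card_fin, mul_one, one_mul] at hdet
  refine mul_right_cancel₀ (pow_ne_zero s ha) ?_
  rw [hdet, mul_right_comm, ← pow_add, Nat.sub_add_cancel hsr]

/-- The form `(u - i v) / 2`, for which `u x + v y = Re (2 (x + i y) ξ)` on real lines. -/
noncomputable def xiForm : MvPolynomial (Fin 3) ℂ :=
  C (1 / 2) * (X 0 - C Complex.I * X 1)

/-- The form `(u + i v) / 2`, conjugate to `xiForm`. -/
noncomputable def xiConjForm : MvPolynomial (Fin 3) ℂ :=
  C (1 / 2) * (X 0 + C Complex.I * X 1)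

lemma C_I_mul_C_I : (C Complex.I * C Complex.I : MvPolynomial (Fin 3) ℂ) = -1 := by
  rw [← C_mul, Complex.I_mul_I, C_neg, C_1]

lemma C_half_mul_two : (C (1 / 2) * 2 : MvPolynomial (Fin 3) ℂ) = 1 := by
  rw [show (2 : MvPolynomial (Fin 3) ℂ) = C 2 from rfl, ← C_mul]
  norm_num

lemma pointForm_eq_xiForm (f : ℂ) :
    pointForm f = C f * xiForm + C (star f) * xiConjForm + X 2 := by
  have h1 : (C f : MvPolynomial (Fin 3) ℂ) = C (f.re : ℂ) + C (f.im : ℂ) * C Complex.I := by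
    rw [← C_mul, ← C_add, Complex.re_add_im]
  have h2 : (C (star f) : MvPolynomial (Fin 3) ℂ) = C (f.re : ℂ) - C (f.im : ℂ) * C Complex.I := by
    rw [← C_mul, ← C_sub]
    congr 1
    apply Complex.ext <;> simp
  rw [h1, h2, pointForm, xiForm, xiConjForm]
  linear_combination (-(C (f.re : ℂ) * X 0 + C (f.im : ℂ) * X 1)) * C_half_mul_two
    + (2 * C (1 / 2) * C (f.im : ℂ) * X 1) * C_I_mul_C_I

lemma xiForm_mul_xiConjForm : xiForm * xiConjForm = C (1 / 4) * (X 0 ^ 2 + X 1 ^ 2) := by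
  have : (C (1 / 4) : MvPolynomial (Fin 3) ℂ) = C (1 / 2) * C (1 / 2) := by
    rw [← C_mul]; norm_num
  rw [xiForm, xiConjForm, this]
  linear_combination (-(C (1 / 2) * C (1 / 2) * X 1 ^ 2)) * C_I_mul_C_I

/-- One entry of `u Re^J(A) + v Im^J(A)`, in terms of the entries `x` of `A` and `y` of `A^#`. -/
lemma xiForm_entry (x y : ℂ) :
    X 0 * C (1 / 2 * (x + y)) + X 1 * C (1 / (2 * Complex.I) * (x - y)) =
      xiForm * C x + xiConjForm * C y := by
  have : 1 / (2 * Complex.I) * (x - y) = -(Complex.I * (1 / 2 * (x - y))) := by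
    rw [one_div, mul_inv, Complex.inv_I]; ring
  rw [this, xiForm, xiConjForm]
  simp only [C_neg, C_mul, C_add, C_sub]
  ring

lemma kippenhahn_matrix_eq {r s : ℕ} (α β : ℂ) (A : Matrix (Fin r) (Fin s) ℂ)
    (B : Matrix (Fin s) (Fin r) ℂ) :
    (X 0 : MvPolynomial (Fin 3) ℂ) • (rePart (inertia r s) (blockMatrix α β A B)).map C
      + (X 1 : MvPolynomial (Fin 3) ℂ) • (imPart (inertia r s) (blockMatrix α β A B)).map C
      + (X 2 : MvPolynomial (Fin 3) ℂ) •
        (1 : Matrix (Fin r ⊕ Fin s) (Fin r ⊕ Fin s) (MvPolynomial (Fin 3) ℂ)) =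
    fromBlocks (pointForm α • 1) (xiForm • A.map C - xiConjForm • Bᴴ.map C)
      (xiForm • B.map C - xiConjForm • Aᴴ.map C) (pointForm β • 1) := by
  have hadj : adjointJ (inertia r s) (blockMatrix α β A B) =
      fromBlocks (star α • 1) (-Bᴴ) (-Aᴴ) (star β • 1) := by
    simp [adjointJ, inertia, blockMatrix, fromBlocks_conjTranspose, fromBlocks_multiply]
  ext1 i j
  have hentry : ∀ x y : ℂ, ∀ k : MvPolynomial (Fin 3) ℂ,
      blockMatrix α β A B i j = x → adjointJ (inertia r s) (blockMatrix α β A B) i j = y →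
      ((X 2 : MvPolynomial (Fin 3) ℂ) •
        (1 : Matrix (Fin r ⊕ Fin s) (Fin r ⊕ Fin s) (MvPolynomial (Fin 3) ℂ))) i j = k →
      ((X 0 : MvPolynomial (Fin 3) ℂ) • (rePart (inertia r s) (blockMatrix α β A B)).map C
      + (X 1 : MvPolynomial (Fin 3) ℂ) • (imPart (inertia r s) (blockMatrix α β A B)).map C
      + (X 2 : MvPolynomial (Fin 3) ℂ) •
        (1 : Matrix (Fin r ⊕ Fin s) (Fin r ⊕ Fin s) (MvPolynomial (Fin 3) ℂ)) :
        Matrix (Fin r ⊕ Fin s) (Fin r ⊕ Fin s) (MvPolynomial (Fin 3) ℂ)) i j =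
        xiForm * C x + xiConjForm * C y + k := by
    rintro x y k rfl rfl rfl
    rw [← xiForm_entry]
    rfl
  rw [hentry _ _ _ rfl rfl rfl, hadj]
  rcases i with i | i <;> rcases j with j | j
  · by_cases hij : i = j
    · subst hij
      simp [blockMatrix, pointForm_eq_xiForm, mul_comm]
    · simp [blockMatrix, hij]
  · simp [blockMatrix, sub_eq_add_neg]
  · simp [blockMatrix, sub_eq_add_neg]
  · by_cases hij : i = j
    · subst hij
      simp [blockMatrix, pointForm_eq_xiForm, mul_comm]
    · simp [blockMatrix, hij]

/-- The determinantal form splits off one factor for each eigenvalue `h j` of `C^* C + D D^*`: the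
lower-left block times the upper-right block is a scalar matrix minus a multiple of
`C^* C + D D^*`. -/
lemma kippenhahnPoly_eq {r s : ℕ} (hsr : s ≤ r) (α β z : ℂ)
    {A : Matrix (Fin r) (Fin s) ℂ} {B : Matrix (Fin s) (Fin r) ℂ}
    (hBA : B * A = z • (1 : Matrix (Fin s) (Fin s) ℂ))
    {U : Matrix (Fin s) (Fin s) ℂ} (hU : U ∈ Matrix.unitaryGroup (Fin s) ℂ) {h : Fin s → ℝ}
    (hdiag : Uᴴ * (Aᴴ * A + B * Bᴴ) * U = Matrix.diagonal (fun j => (h j : ℂ))) :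
    kippenhahnPoly (inertia r s) (blockMatrix α β A B) = pointForm α ^ (r - s) *
      ∏ j, (pointForm α * pointForm β + C (h j : ℂ) * (xiForm * xiConjForm)
        - C z * xiForm ^ 2 - C (star z) * xiConjForm ^ 2) := by
  rw [kippenhahnPoly, kippenhahn_matrix_eq,
    det_fromBlocks_smul_one hsr (irreducible_pointForm α).ne_zero]
  congr 1
  have hUU : Uᴴ * U = 1 := (mem_unitaryGroup_iff').1 hU
  have hBA' : Aᴴ * Bᴴ = star z • (1 : Matrix (Fin s) (Fin s) ℂ) := by
    rw [← conjTranspose_mul, hBA, conjTranspose_smul, conjTranspose_one]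
  set φ : ℂ →+* MvPolynomial (Fin 3) ℂ := C with hφ
  have hmap {k l n : ℕ} (M : Matrix (Fin k) (Fin l) ℂ) (N : Matrix (Fin l) (Fin n) ℂ) :
      (M * N).map φ = M.map φ * N.map φ :=
    Matrix.map_mul (f := φ)
  have hone {k : ℕ} (w : ℂ) : (w • (1 : Matrix (Fin k) (Fin k) ℂ)).map φ =
      φ w • (1 : Matrix (Fin k) (Fin k) (MvPolynomial (Fin 3) ℂ)) := by
    ext1 i j
    by_cases hij : i = j <;> simp [hij]
  have hUU' : Uᴴ.map φ * U.map φ = 1 := by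
    rw [← hmap, hUU]
    exact Matrix.map_one _ φ.map_zero φ.map_one
  have hD : Uᴴ.map φ * (Aᴴ.map φ * A.map φ + B.map φ * Bᴴ.map φ)
      * U.map φ = diagonal fun j => φ (h j : ℂ) := by
    rw [← hmap, ← hmap, ← Matrix.map_add _ (fun _ _ => φ.map_add _ _), ← hmap, ← hmap, hdiag,
      diagonal_map φ.map_zero]
  set a := pointForm α * pointForm β - φ z * xiForm ^ 2 - φ (star z) * xiConjForm ^ 2 with ha
  have hsplit : (pointForm α * pointForm β) • (1 : Matrix (Fin s) (Fin s) _)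
      - (xiForm • B.map φ - xiConjForm • Aᴴ.map φ) * (xiForm • A.map φ - xiConjForm • Bᴴ.map φ)
      = a • (1 : Matrix (Fin s) (Fin s) (MvPolynomial (Fin 3) ℂ)) +
        (xiForm * xiConjForm) • (Aᴴ.map φ * A.map φ + B.map φ * Bᴴ.map φ) := by
    have e1 := hone (k := s) z
    have e2 := hone (k := s) (star z)
    rw [← hBA, hmap] at e1
    rw [← hBA', hmap] at e2
    simp only [Matrix.sub_mul, Matrix.mul_sub, Matrix.smul_mul, Matrix.mul_smul, smul_smul, e1, e2,
      ha]
    module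
  have hconj : Uᴴ.map φ *
      (a • (1 : Matrix (Fin s) (Fin s) (MvPolynomial (Fin 3) ℂ)) +
        (xiForm * xiConjForm) • (Aᴴ.map φ * A.map φ + B.map φ * Bᴴ.map φ)) * U.map φ =
      diagonal fun j => a + xiForm * xiConjForm * φ (h j : ℂ) := by
    rw [Matrix.mul_add, Matrix.add_mul, Matrix.mul_smul, Matrix.mul_one, Matrix.smul_mul, hUU',
      Matrix.mul_smul, Matrix.smul_mul, hD]
    ext1 i j
    by_cases hij : i = j <;> simp [hij]
  have hdet := congrArg det hconj
  rw [det_mul, det_mul, mul_right_comm, ← det_mul, hUU', det_one, one_mul, det_diagonal] at hdet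
  rw [hsplit, hdet]
  refine Finset.prod_congr rfl fun j _ => ?_
  rw [ha]
  ring

/-- The factor belonging to an eigenvalue `h` is the quadratic form of a conic with foci `g ± e`,
where `g` is the midpoint of `α` and `β` and `e ^ 2 = ((α - β) / 2) ^ 2 + z`. -/
lemma conicPoly_eq {g d e z : ℂ} (he : e ^ 2 = d ^ 2 + z) {h m : ℝ}
    (hm : m = h + 2 * ‖e‖ ^ 2 - 2 * ‖d‖ ^ 2) :
    pointForm (g + d) * pointForm (g - d) + C (h : ℂ) * (xiForm * xiConjForm)
        - C z * xiForm ^ 2 - C (star z) * xiConjForm ^ 2 = conicPoly g e m := by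
  have hz : z = e ^ 2 - d ^ 2 := by rw [he]; ring
  have hm' : (m : ℂ) / 4 = 1 / 4 * (h + 2 * (e * star e) - 2 * (d * star d)) := by
    have hn (w : ℂ) : w * star w = ((‖w‖ ^ 2 : ℝ) : ℂ) := by
      simpa using Complex.mul_conj' w
    rw [hn, hn, hm]
    push_cast
    ring
  have hq : C ((m : ℂ) / 4) * (X 0 ^ 2 + X 1 ^ 2) =
      C (h + 2 * (e * star e) - 2 * (d * star d)) * (xiForm * xiConjForm) := by
    rw [hm', C_mul, xiForm_mul_xiConjForm]
    ring
  have h2 : (C 2 : MvPolynomial (Fin 3) ℂ) = 2 := rfl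
  rw [conicPoly, hq, hz]
  simp only [pointForm_eq_xiForm, star_add, star_sub, star_pow, C_add, C_sub, C_mul, C_pow, h2]
  ring

end KreinRange

/-! ### The numerical range in terms of the two components of a vector -/

namespace KreinRange

open Complex

/-- The squared Euclidean norm of a complex vector. -/
noncomputable def normSqVec {ι : Type*} [Fintype ι] (v : ι → ℂ) : ℝ := ∑ i, ‖v i‖ ^ 2

lemma star_dotProduct_self {ι : Type*} [Fintype ι] (v : ι → ℂ) :
    star v ⬝ᵥ v = (normSqVec v : ℂ) := by
  simp [dotProduct, normSqVec, Complex.conj_mul']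

lemma normSqVec_nonneg {ι : Type*} [Fintype ι] (v : ι → ℂ) : 0 ≤ normSqVec v :=
  Finset.sum_nonneg fun _ _ => sq_nonneg _

lemma normSqVec_eq_zero {ι : Type*} [Fintype ι] {v : ι → ℂ} (h : normSqVec v = 0) : v = 0 := by
  have := (Finset.sum_eq_zero_iff_of_nonneg fun _ _ => sq_nonneg _).1 h
  funext i
  simpa using this i (Finset.mem_univ i)

lemma normSqVec_smul {ι : Type*} [Fintype ι] (c : ℂ) (v : ι → ℂ) :
    normSqVec (c • v) = ‖c‖ ^ 2 * normSqVec v := by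
  simp [normSqVec, mul_pow, Finset.mul_sum]

lemma re_dotProduct_sq_le {ι : Type*} [Fintype ι] (p v : ι → ℂ) :
    (star p ⬝ᵥ v).re ^ 2 ≤ normSqVec p * normSqVec v := by
  have h := norm_inner_le_norm (𝕜 := ℂ) (WithLp.toLp 2 p : EuclideanSpace ℂ ι) (WithLp.toLp 2 v)
  have h1 (w : ι → ℂ) : ‖(WithLp.toLp 2 w : EuclideanSpace ℂ ι)‖ ^ 2 = normSqVec w :=
    EuclideanSpace.norm_sq_eq _
  rw [EuclideanSpace.inner_eq_star_dotProduct] at h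
  rw [← h1, ← h1, ← mul_pow, dotProduct_comm]
  exact sq_le_sq' (by linarith [abs_le.1 (abs_re_le_norm (v ⬝ᵥ star p))])
    (by linarith [abs_le.1 (abs_re_le_norm (v ⬝ᵥ star p))])

variable {r s : ℕ}

/-- The off-diagonal contribution `p^* C q - q^* D p` to `[Ax, x]_J` for `x = (p, q)`. -/
def crossTerm (C : Matrix (Fin r) (Fin s) ℂ) (D : Matrix (Fin s) (Fin r) ℂ)
    (p : Fin r → ℂ) (q : Fin s → ℂ) : ℂ :=
  star p ⬝ᵥ (C *ᵥ q) - star q ⬝ᵥ (D *ᵥ p)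

lemma indefInner_inertia (p p' : Fin r → ℂ) (q q' : Fin s → ℂ) :
    indefInner (inertia r s) (Sum.elim p q) (Sum.elim p' q') = star p' ⬝ᵥ p - star q' ⬝ᵥ q := by
  have : star (Sum.elim p' q') = Sum.elim (star p') (star q') := by
    funext i; rcases i with i | i <;> rfl
  rw [indefInner, inertia, fromBlocks_mulVec, this, sumElim_dotProduct_sumElim]
  simp [neg_mulVec, sub_eq_add_neg]

lemma indefInner_blockMatrix (α β : ℂ) (C : Matrix (Fin r) (Fin s) ℂ)
    (D : Matrix (Fin s) (Fin r) ℂ) (p : Fin r → ℂ) (q : Fin s → ℂ) :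
    indefInner (inertia r s) (blockMatrix α β C D *ᵥ Sum.elim p q) (Sum.elim p q) =
      α * normSqVec p - β * normSqVec q + crossTerm C D p q := by
  rw [blockMatrix, fromBlocks_mulVec, indefInner_inertia, crossTerm]
  simp [smul_mulVec, dotProduct_add, star_dotProduct_self]
  ring

/-- Points of the numerical range; the sign `ε` of `[x, x]_J` treats both parts at once, and the
block diagonal contributes a multiple of `d`, half the difference of the diagonal entries. -/
lemma mem_numRange_iff (g d : ℂ) (C : Matrix (Fin r) (Fin s) ℂ)
    (D : Matrix (Fin s) (Fin r) ℂ) (w : ℂ) :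
    w ∈ numRange (inertia r s) (blockMatrix (g + d) (g - d) C D) ↔
      ∃ (ε : ℝ) (p : Fin r → ℂ) (q : Fin s → ℂ), ε ^ 2 = 1 ∧ normSqVec p - normSqVec q = ε ∧
        w - g = ε * (d * (normSqVec p + normSqVec q : ℝ) + crossTerm C D p q) := by
  have hx (x : Fin r ⊕ Fin s → ℂ) : x = Sum.elim (x ∘ Sum.inl) (x ∘ Sum.inr) :=
    (Sum.elim_comp_inl_inr x).symm
  have hform (p : Fin r → ℂ) (q : Fin s → ℂ) (ε : ℝ) :
      indefInner (inertia r s) (Sum.elim p q) (Sum.elim p q) = (ε : ℂ) ↔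
        normSqVec p - normSqVec q = ε := by
    rw [indefInner_inertia, star_dotProduct_self, star_dotProduct_self]
    norm_cast
  constructor
  · rintro (⟨x, h1, h2⟩ | ⟨x, h1, h2⟩)
    · rw [hx x] at h1 h2
      have h1' := (hform _ _ (-1)).1 (by rw [h1]; simp)
      rw [indefInner_blockMatrix] at h2
      refine ⟨-1, _, _, by norm_num, h1', ?_⟩
      have hc : (normSqVec (x ∘ Sum.inl) : ℂ) - normSqVec (x ∘ Sum.inr) = -1 := by
        exact_mod_cast h1'
      push_cast
      linear_combination -h2 - g * hc
    · rw [hx x] at h1 h2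
      have h1' := (hform _ _ 1).1 (by rw [h1]; simp)
      rw [indefInner_blockMatrix] at h2
      refine ⟨1, _, _, by norm_num, h1', ?_⟩
      have hc : (normSqVec (x ∘ Sum.inl) : ℂ) - normSqVec (x ∘ Sum.inr) = 1 := by
        exact_mod_cast h1'
      push_cast
      linear_combination h2 + g * hc
  · rintro ⟨ε, p, q, hε, h1, h2⟩
    have hc : (normSqVec p : ℂ) - normSqVec q = ε := by exact_mod_cast h1
    rcases (sq_eq_sq_iff_eq_or_eq_neg (b := (1 : ℝ))).1 (by rw [hε, one_pow]) with rfl | rfl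
    · right
      refine ⟨Sum.elim p q, by simpa using (hform p q 1).2 h1, ?_⟩
      rw [indefInner_blockMatrix]
      push_cast at h2 hc
      linear_combination h2 - g * hc
    · left
      refine ⟨Sum.elim p q, by simpa using (hform p q (-1)).2 h1, ?_⟩
      rw [indefInner_blockMatrix]
      push_cast at h2 hc
      linear_combination -h2 - g * hc

/-- The vector `ζ̄ C q - ζ D^* q`, which represents `p ↦ Re (ζ̄ (p^* C q - q^* D p))`. -/
def supportVec (C : Matrix (Fin r) (Fin s) ℂ) (D : Matrix (Fin s) (Fin r) ℂ) (q : Fin s → ℂ)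
    (ζ : ℂ) : Fin r → ℂ :=
  star ζ • (C *ᵥ q) - ζ • (Dᴴ *ᵥ q)

/-- `Re (ζ̄ w)`: the Euclidean inner product of `ℂ = ℝ²`. -/
def rdot (ζ w : ℂ) : ℝ := ζ.re * w.re + ζ.im * w.im

lemma rdot_crossTerm (C : Matrix (Fin r) (Fin s) ℂ) (D : Matrix (Fin s) (Fin r) ℂ)
    (p : Fin r → ℂ) (q : Fin s → ℂ) (ζ : ℂ) :
    rdot ζ (crossTerm C D p q) = (star p ⬝ᵥ supportVec C D q ζ).re := by
  have h : star q ⬝ᵥ (D *ᵥ p) = star (star p ⬝ᵥ (Dᴴ *ᵥ q)) := by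
    rw [star_dotProduct, star_mulVec, dotProduct_mulVec]
  rw [crossTerm, h, supportVec, dotProduct_sub, dotProduct_smul, dotProduct_smul]
  simp [rdot]
  ring

lemma quadratic_apply_of_smul_one {z : ℂ} {M : Matrix (Fin s) (Fin s) ℂ} (hM : M = z • 1)
    (q : Fin s → ℂ) : star q ⬝ᵥ (M *ᵥ q) = z * normSqVec q := by
  rw [hM, smul_mulVec, one_mulVec, dotProduct_smul, star_dotProduct_self, smul_eq_mul]

lemma crossTerm_supportVec {C : Matrix (Fin r) (Fin s) ℂ} {D : Matrix (Fin s) (Fin r) ℂ} {z : ℂ}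
    (hDC : D * C = z • (1 : Matrix (Fin s) (Fin s) ℂ)) (q : Fin s → ℂ) (ζ : ℂ) :
    crossTerm C D (supportVec C D q ζ) q =
      ζ * (star q ⬝ᵥ ((Cᴴ * C + D * Dᴴ) *ᵥ q)) - 2 * star ζ * z * normSqVec q := by
  have h1 := quadratic_apply_of_smul_one hDC q
  simp only [crossTerm, supportVec, star_sub, star_smul, star_star, star_mulVec,
    conjTranspose_conjTranspose, sub_dotProduct, smul_dotProduct, mulVec_sub, mulVec_smul,
    dotProduct_sub, dotProduct_smul, ← dotProduct_mulVec, mulVec_mulVec, smul_eq_mul, add_mulVec,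
    dotProduct_add, h1]
  ring

lemma normSqVec_supportVec {C : Matrix (Fin r) (Fin s) ℂ} {D : Matrix (Fin s) (Fin r) ℂ} {z : ℂ}
    (hDC : D * C = z • (1 : Matrix (Fin s) (Fin s) ℂ)) {q : Fin s → ℂ} {η : ℝ}
    (hη : star q ⬝ᵥ ((Cᴴ * C + D * Dᴴ) *ᵥ q) = η) (ζ : ℂ) :
    normSqVec (supportVec C D q ζ) = η * ‖ζ‖ ^ 2 - 2 * rdot (ζ ^ 2) z * normSqVec q := by
  have h := congrArg Complex.re (star_dotProduct_self (supportVec C D q ζ))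
  rw [← rdot_crossTerm, crossTerm_supportVec hDC, hη, ofReal_re] at h
  rw [← h, norm_sq_eq_re_im]
  simp [rdot, pow_two]
  ring

/-- The squared support function of the ellipse `{p^* C q - q^* D p : ‖p‖ = 1}` for a unit vector
`q` with `q^* (C^* C + D D^*) q = η`. -/
lemma rdot_crossTerm_sq_le {C : Matrix (Fin r) (Fin s) ℂ} {D : Matrix (Fin s) (Fin r) ℂ} {z : ℂ}
    (hDC : D * C = z • (1 : Matrix (Fin s) (Fin s) ℂ)) {q : Fin s → ℂ} {η : ℝ}
    (hη : star q ⬝ᵥ ((Cᴴ * C + D * Dᴴ) *ᵥ q) = η) (p : Fin r → ℂ) (ζ : ℂ) :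
    rdot ζ (crossTerm C D p q) ^ 2 ≤
      normSqVec p * (η * ‖ζ‖ ^ 2 - 2 * rdot (ζ ^ 2) z * normSqVec q) := by
  rw [rdot_crossTerm, ← normSqVec_supportVec hDC hη]
  exact re_dotProduct_sq_le _ _

/-! ### The spectral decomposition of `C^* C + D D^*` -/

lemma normSqVec_conjTranspose_mulVec {U : Matrix (Fin s) (Fin s) ℂ}
    (hU : U ∈ Matrix.unitaryGroup (Fin s) ℂ) (q : Fin s → ℂ) :
    normSqVec (Uᴴ *ᵥ q) = normSqVec q := by
  have hUU : U * Uᴴ = 1 := mem_unitaryGroup_iff.1 hU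
  have := star_dotProduct_self (Uᴴ *ᵥ q)
  rw [star_mulVec, conjTranspose_conjTranspose, ← dotProduct_mulVec, mulVec_mulVec, hUU, one_mulVec,
    star_dotProduct_self] at this
  exact_mod_cast this.symm

lemma eq_of_conjTranspose_mul_mul_eq {H U : Matrix (Fin s) (Fin s) ℂ}
    (hU : U ∈ Matrix.unitaryGroup (Fin s) ℂ) {T : Matrix (Fin s) (Fin s) ℂ} (hT : Uᴴ * H * U = T) :
    H = U * T * Uᴴ := by
  have hUU : U * Uᴴ = 1 := mem_unitaryGroup_iff.1 hU
  calc H = (U * Uᴴ) * H * (U * Uᴴ) := by rw [hUU, one_mul, mul_one]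
    _ = U * T * Uᴴ := by rw [← hT]; simp only [Matrix.mul_assoc]

lemma quadratic_apply_eq_sum {H U : Matrix (Fin s) (Fin s) ℂ}
    (hU : U ∈ Matrix.unitaryGroup (Fin s) ℂ) {h : Fin s → ℝ}
    (hdiag : Uᴴ * H * U = Matrix.diagonal (fun j => (h j : ℂ))) (q : Fin s → ℂ) :
    star q ⬝ᵥ (H *ᵥ q) = ((∑ j, h j * ‖(Uᴴ *ᵥ q) j‖ ^ 2 : ℝ) : ℂ) := by
  rw [eq_of_conjTranspose_mul_mul_eq hU hdiag, ← mulVec_mulVec, ← mulVec_mulVec, dotProduct_mulVec]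
  have : star q ᵥ* U = star (Uᴴ *ᵥ q) := by rw [star_mulVec, conjTranspose_conjTranspose]
  rw [this, dotProduct]
  push_cast
  refine Finset.sum_congr rfl fun j _ => ?_
  rw [mulVec_diagonal, ← Complex.conj_mul', Pi.star_apply, RCLike.star_def]
  ring

lemma exists_quadratic_apply_le {H U : Matrix (Fin s) (Fin s) ℂ}
    (hU : U ∈ Matrix.unitaryGroup (Fin s) ℂ) {h : Fin s → ℝ}
    (hdiag : Uᴴ * H * U = Matrix.diagonal (fun j => (h j : ℂ))) {j₁ : Fin s}
    (hj₁ : ∀ j, h j ≤ h j₁) (q : Fin s → ℂ) :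
    ∃ η : ℝ, star q ⬝ᵥ (H *ᵥ q) = η ∧ η ≤ h j₁ * normSqVec q := by
  refine ⟨_, quadratic_apply_eq_sum hU hdiag q, ?_⟩
  rw [← normSqVec_conjTranspose_mulVec hU q, normSqVec, Finset.mul_sum]
  exact Finset.sum_le_sum fun j _ => mul_le_mul_of_nonneg_right (hj₁ j) (sq_nonneg _)

lemma exists_unit_eigenvector {H U : Matrix (Fin s) (Fin s) ℂ}
    (hU : U ∈ Matrix.unitaryGroup (Fin s) ℂ) {h : Fin s → ℝ}
    (hdiag : Uᴴ * H * U = Matrix.diagonal (fun j => (h j : ℂ))) (j : Fin s) :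
    ∃ q : Fin s → ℂ, normSqVec q = 1 ∧ star q ⬝ᵥ (H *ᵥ q) = (h j : ℂ) := by
  have hUU : Uᴴ * U = 1 := mem_unitaryGroup_iff'.1 hU
  have hq : Uᴴ *ᵥ (U *ᵥ Pi.single j 1) = Pi.single j 1 := by
    rw [mulVec_mulVec, hUU, one_mulVec]
  refine ⟨U *ᵥ Pi.single j 1, ?_, ?_⟩
  · rw [← normSqVec_conjTranspose_mulVec hU, hq, normSqVec, Finset.sum_eq_single j]
    · simp
    · intro k _ hk; simp [hk]
    · simp
  · rw [quadratic_apply_eq_sum hU hdiag, hq, Finset.sum_eq_single j]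
    · simp
    · intro k _ hk; simp [hk]
    · simp

lemma euclideanOpNorm_eq {H U : Matrix (Fin s) (Fin s) ℂ}
    (hU : U ∈ Matrix.unitaryGroup (Fin s) ℂ) {h : Fin s → ℝ}
    (hdiag : Uᴴ * H * U = Matrix.diagonal (fun j => (h j : ℂ))) {j₁ : Fin s}
    (hj₁ : ∀ j, h j ≤ h j₁) (h0 : ∀ j, 0 ≤ h j) : euclideanOpNorm H = h j₁ := by
  open scoped Matrix.Norms.L2Operator in
  have key : ‖H‖ = ‖Matrix.diagonal (fun j => (h j : ℂ))‖ := by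
    have hU' : Uᴴ ∈ unitary (Matrix (Fin s) (Fin s) ℂ) := Unitary.star_mem hU
    rw [← hdiag, CStarRing.norm_mul_mem_unitary _ hU, CStarRing.norm_mem_unitary_mul _ hU']
  rw [euclideanOpNorm, Matrix.l2_opNorm_toEuclideanCLM, key, Matrix.l2_opNorm_diagonal]
  have hnorm (j : Fin s) : ‖(h j : ℂ)‖ = h j := by
    rw [Complex.norm_real, Real.norm_of_nonneg (h0 j)]
  refine le_antisymm ((pi_norm_le_iff_of_nonneg (h0 j₁)).2 fun j => ?_) ?_
  · rw [hnorm]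
    exact hj₁ j
  · rw [← hnorm j₁]
    exact norm_le_pi_norm (fun j => (h j : ℂ)) j₁

end KreinRange

namespace KreinRange

open Complex

variable {r s : ℕ}

/-! ### The numerical range is the region bounded by a conic -/

/-- The squared support function of the ellipse of cross terms, in terms of half the difference `d`
of the diagonal entries and the half focal distance `e`. -/
lemma support_eq {d e z : ℂ} (he : e ^ 2 = d ^ 2 + z) {h m : ℝ}
    (hm : m = h + 2 * ‖e‖ ^ 2 - 2 * ‖d‖ ^ 2) (ζ : ℂ) :
    h * ‖ζ‖ ^ 2 - 2 * rdot (ζ ^ 2) z =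
      4 * (rdot ζ d ^ 2 - (rdot ζ e ^ 2 - m / 4 * ‖ζ‖ ^ 2)) := by
  have hz : z = e ^ 2 - d ^ 2 := by rw [he]; ring
  rw [hm, hz, norm_sq_eq_re_im, norm_sq_eq_re_im, norm_sq_eq_re_im]
  simp [rdot, pow_two]
  ring

lemma le_conicForm_of_forall_rdot {e Z : ℂ} {n m : ℝ} (hnm : n + m = 4 * ‖e‖ ^ 2)
    (h : ∀ ζ : ℂ, rdot ζ e ^ 2 - m / 4 * ‖ζ‖ ^ 2 ≤ rdot ζ Z ^ 2) : n * m ≤ conicForm e m Z := by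
  rw [norm_sq_eq_re_im] at hnm
  have key : ∀ x : ℝ, 0 ≤ (Z.re ^ 2 - e.re ^ 2 + m / 4) * (x * x) +
      2 * (Z.re * Z.im - e.re * e.im) * x + (Z.im ^ 2 - e.im ^ 2 + m / 4) := by
    intro x
    have := h ⟨x, 1⟩
    rw [norm_sq_eq_re_im] at this
    simp only [rdot] at this
    linarith
  have := discrim_le_zero key
  rw [discrim] at this
  rw [conicForm]
  have hn : n = 4 * (e.re ^ 2 + e.im ^ 2) - m := by linarith
  rw [hn]
  linarith

/-- At `ζ`, the value of the dual form of the hyperboloid `c² - ‖x‖² = 1` is at most the square of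
the coordinate of any point `d c + σ` of its image: a reversed Cauchy–Schwarz inequality. -/
lemma rdot_lower_bound {c : ℝ} (hc : 1 ≤ c) {d σ ζ : ℂ} {b : ℝ}
    (h0 : b ≤ rdot ζ d ^ 2)
    (hσ : rdot ζ σ ^ 2 ≤ (c ^ 2 - 1) * (rdot ζ d ^ 2 - b)) :
    b ≤ rdot ζ (d * c + σ) ^ 2 := by
  have ht : rdot ζ (d * c + σ) = c * rdot ζ d + rdot ζ σ := by
    simp [rdot]; ring
  rw [ht]
  set u := rdot ζ d
  set v := rdot ζ σ
  rcases hc.eq_or_lt with rfl | hc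
  · have : v = 0 := by nlinarith
    rw [this]
    linarith
  · have hpos : 0 < c ^ 2 - 1 := by nlinarith
    have : 0 ≤ (c ^ 2 - 1) * ((c * u + v) ^ 2 - b) := by
      nlinarith [sq_nonneg ((c ^ 2 - 1) * u + c * v)]
    linarith [nonneg_of_mul_nonneg_right this hpos]

lemma normSqVec_add_ge_one {p : Fin r → ℂ} {q : Fin s → ℂ} {ε : ℝ} (hε : ε ^ 2 = 1)
    (h : normSqVec p - normSqVec q = ε) : 1 ≤ normSqVec p + normSqVec q := by
  have hp := normSqVec_nonneg p
  have hq := normSqVec_nonneg q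
  nlinarith

lemma conicForm_smul_sign (e : ℂ) (m : ℝ) (Z : ℂ) {ε : ℝ} (hε : ε ^ 2 = 1) :
    conicForm e m (ε * Z) = conicForm e m Z := by
  simp only [conicForm, re_ofReal_mul, im_ofReal_mul]
  linear_combination (4 * m * (Z.re ^ 2 + Z.im ^ 2) - 16 * (e.re * Z.im - e.im * Z.re) ^ 2) * hε

lemma le_conicForm_of_mem_numRange {g d e z : ℂ} {C : Matrix (Fin r) (Fin s) ℂ}
    {D : Matrix (Fin s) (Fin r) ℂ} (hDC : D * C = z • (1 : Matrix (Fin s) (Fin s) ℂ))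
    (he : e ^ 2 = d ^ 2 + z) {h n m : ℝ} (hm : m = h + 2 * ‖e‖ ^ 2 - 2 * ‖d‖ ^ 2)
    (hnm : n + m = 4 * ‖e‖ ^ 2)
    (hle : ∀ q : Fin s → ℂ, ∃ η : ℝ, star q ⬝ᵥ ((Cᴴ * C + D * Dᴴ) *ᵥ q) = η ∧
      η ≤ h * normSqVec q)
    (hpos : ∀ ζ : ℂ, 0 ≤ h * ‖ζ‖ ^ 2 - 2 * rdot (ζ ^ 2) z) {w : ℂ}
    (hw : w ∈ numRange (inertia r s) (blockMatrix (g + d) (g - d) C D)) :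
    n * m ≤ conicForm e m (w - g) := by
  obtain ⟨ε, p, q, hε, hpq, hwg⟩ := (mem_numRange_iff g d C D w).1 hw
  rw [hwg, conicForm_smul_sign _ _ _ hε]
  refine le_conicForm_of_forall_rdot hnm fun ζ => ?_
  have hsupp := support_eq he hm ζ
  have h0 := hpos ζ
  refine rdot_lower_bound (normSqVec_add_ge_one hε hpq) (by linarith) ?_
  obtain ⟨η, hη, hηle⟩ := hle q
  have hσ := rdot_crossTerm_sq_le hDC hη p ζ
  have h4 : (normSqVec p + normSqVec q) ^ 2 - 1 = 4 * (normSqVec p * normSqVec q) := by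
    rw [← hε, ← hpq]; ring
  have hp := normSqVec_nonneg p
  have : normSqVec p * (η * ‖ζ‖ ^ 2 - 2 * rdot (ζ ^ 2) z * normSqVec q) ≤
      normSqVec p * (normSqVec q * (h * ‖ζ‖ ^ 2 - 2 * rdot (ζ ^ 2) z)) := by
    refine mul_le_mul_of_nonneg_left ?_ hp
    nlinarith [mul_le_mul_of_nonneg_right hηle (sq_nonneg ‖ζ‖)]
  rw [h4]
  rw [hsupp] at this
  linarith

lemma crossTerm_smul_right (C : Matrix (Fin r) (Fin s) ℂ) (D : Matrix (Fin s) (Fin r) ℂ)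
    (p : Fin r → ℂ) (q : Fin s → ℂ) (b : ℝ) :
    crossTerm C D p ((b : ℂ) • q) = b * crossTerm C D p q := by
  simp [crossTerm, mulVec_smul]; ring

lemma crossTerm_smul_left (C : Matrix (Fin r) (Fin s) ℂ) (D : Matrix (Fin s) (Fin r) ℂ)
    (p : Fin r → ℂ) (q : Fin s → ℂ) (b : ℝ) :
    crossTerm C D ((b : ℂ) • p) q = b * crossTerm C D p q := by
  simp [crossTerm, mulVec_smul]; ring

/-- `p ↦ p^* C q - q^* D p` as a real-linear map. -/
noncomputable def crossMap (C : Matrix (Fin r) (Fin s) ℂ) (D : Matrix (Fin s) (Fin r) ℂ)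
    (q : Fin s → ℂ) : (Fin r → ℂ) →ₗ[ℝ] ℂ where
  toFun p := crossTerm C D p q
  map_add' p p' := by
    simp [crossTerm, add_dotProduct, mulVec_add]; ring
  map_smul' c p := by
    have : (c • p : Fin r → ℂ) = (c : ℂ) • p := by ext; simp
    rw [this, crossTerm_smul_left]
    simp

/-- The linear map whose restriction to the hyperboloid `c² - ‖p‖² = 1` has its image in the
numerical range, up to translation. -/
noncomputable def sheetMap (d : ℂ) (C : Matrix (Fin r) (Fin s) ℂ) (D : Matrix (Fin s) (Fin r) ℂ)
    (q : Fin s → ℂ) : ℝ × (Fin r → ℂ) →ₗ[ℝ] ℂ :=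
  (LinearMap.toSpanSingleton ℝ ℂ d).coprod ((1 / 2 : ℝ) • crossMap C D q)

lemma sheetMap_apply (d : ℂ) (C : Matrix (Fin r) (Fin s) ℂ) (D : Matrix (Fin s) (Fin r) ℂ)
    (q : Fin s → ℂ) (c : ℝ) (p : Fin r → ℂ) :
    sheetMap d C D q (c, p) = d * c + crossTerm C D p q / 2 := by
  simp [sheetMap, crossMap]
  ring

lemma exists_kernel_sheetMap (hr : 0 < r) (d : ℂ) (C : Matrix (Fin r) (Fin s) ℂ)
    (D : Matrix (Fin s) (Fin r) ℂ) (q : Fin s → ℂ) :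
    ∃ x : ℝ × (Fin r → ℂ), x ≠ 0 ∧ sheetMap d C D q x = 0 := by
  have hlt : Module.finrank ℝ ℂ < Module.finrank ℝ (ℝ × (Fin r → ℂ)) := by
    rw [Module.finrank_prod, Module.finrank_pi_fintype]
    simp [Complex.finrank_real_complex]
    omega
  obtain ⟨x, hx, hx0⟩ := Submodule.exists_mem_ne_zero_of_ne_bot
    (LinearMap.ker_ne_bot_of_finrank_lt (f := sheetMap d C D q) hlt)
  exact ⟨x, hx0, hx⟩

/-- Points over the hyperboloid `c² - ‖p‖² = 1` give points of the numerical range. -/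
lemma mem_numRange_of_sheetMap (hr : 0 < r) (g d : ℂ) (C : Matrix (Fin r) (Fin s) ℂ)
    (D : Matrix (Fin s) (Fin r) ℂ) {q : Fin s → ℂ} (hq : normSqVec q = 1) {c : ℝ}
    {p : Fin r → ℂ} (hcp : c ^ 2 - normSqVec p = 1) {w : ℂ}
    (hw : sheetMap d C D q (c, p) = w - g) :
    w ∈ numRange (inertia r s) (blockMatrix (g + d) (g - d) C D) := by
  -- `ε` is the sign of `c`, so that `ε c` is the sum of the squared norms of the two components
  obtain ⟨ε, hε, hc⟩ : ∃ ε : ℝ, ε ^ 2 = 1 ∧ 1 ≤ ε * c := by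
    have hp := normSqVec_nonneg p
    rcases le_total 0 c with h | h
    · exact ⟨1, by norm_num, by nlinarith⟩
    · exact ⟨-1, by norm_num, by nlinarith⟩
  rw [sheetMap_apply] at hw
  rw [mem_numRange_iff]
  have hεC : (ε : ℂ) ^ 2 = 1 := by exact_mod_cast hε
  have hε1 : ε ≤ 1 := by nlinarith
  set b := (ε * c - ε) / 2 with hb
  have hb0 : 0 ≤ b := by rw [hb]; linarith
  rcases hb0.eq_or_lt with hb0 | hb0
  · have hc1 : c = 1 := by
      have : ε * (c - 1) = 0 := by linarith
      rcases mul_eq_zero.1 this with h | h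
      · rw [h] at hε; norm_num at hε
      · linarith
    have hp0 : p = 0 := normSqVec_eq_zero (by rw [hc1] at hcp; linarith)
    have hε1 : ε = 1 := by rw [hc1] at hc; linarith
    refine ⟨1, Pi.single ⟨0, hr⟩ 1, 0, by norm_num, ?_, ?_⟩
    · rw [normSqVec, normSqVec, Finset.sum_eq_single ⟨0, hr⟩]
      · simp
      · intro k _ hk; simp [hk]
      · simp
    · rw [← hw, hp0, hc1, normSqVec, normSqVec, Finset.sum_eq_single ⟨0, hr⟩]
      · simp [crossTerm]
      · intro k _ hk; simp [hk]
      · simp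
  · have hsb : √b ^ 2 = b := Real.sq_sqrt hb0.le
    have hsb0 : √b ≠ 0 := (Real.sqrt_pos.2 hb0).ne'
    have hnp : normSqVec p = 4 * b * (b + ε) := by
      rw [hb]
      have : normSqVec p = c ^ 2 - 1 := by linarith
      rw [this]
      linear_combination (1 - c ^ 2) * hε
    have hP : normSqVec (((ε / (2 * √b) : ℝ) : ℂ) • p) = b + ε := by
      rw [normSqVec_smul, Complex.norm_real, Real.norm_eq_abs, sq_abs, div_pow, mul_pow, hsb, hnp,
        hε]
      field_simp
      norm_num
    have hQ : normSqVec ((√b : ℂ) • q) = b := by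
      rw [normSqVec_smul, Complex.norm_real, Real.norm_eq_abs, sq_abs, hsb, hq, mul_one]
    refine ⟨ε, ((ε / (2 * √b) : ℝ) : ℂ) • p, (√b : ℂ) • q, hε, by rw [hP, hQ]; ring, ?_⟩
    rw [hP, hQ, crossTerm_smul_right, crossTerm_smul_left, ← hw]
    have hsb0' : (√b : ℂ) ≠ 0 := by exact_mod_cast hsb0
    have hsum : b + ε + b = ε * c := by rw [hb]; ring
    rw [hsum]
    push_cast
    field_simp
    linear_combination (-(2 * d * c + crossTerm C D p q)) * hεC

/-- A quadratic function with negative leading coefficient takes every value below one of its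
values. -/
lemma exists_quadratic_eq_one {a b c : ℝ} (ha : a < 0) (hc : 1 ≤ c) :
    ∃ t : ℝ, a * t ^ 2 + b * t + c = 1 := by
  have hd : 0 ≤ discrim a b (c - 1) := by
    rw [discrim]
    nlinarith [sq_nonneg b, mul_nonneg (neg_nonneg.2 ha.le) (sub_nonneg.2 hc)]
  obtain ⟨t, ht⟩ := exists_quadratic_eq_zero ha.ne ⟨_, (Real.mul_self_sqrt hd).symm⟩
  exact ⟨t, by linear_combination ht⟩

lemma exists_normSqVec_add_smul (p p' : Fin r → ℂ) :
    ∃ b : ℝ, ∀ t : ℝ, normSqVec (p + t • p') = normSqVec p' * t ^ 2 + b * t + normSqVec p := by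
  refine ⟨∑ i, 2 * ((p i).re * (p' i).re + (p i).im * (p' i).im), fun t => ?_⟩
  simp only [normSqVec, Finset.sum_mul, ← Finset.sum_add_distrib]
  refine Finset.sum_congr rfl fun i _ => ?_
  rw [norm_sq_eq_re_im, norm_sq_eq_re_im, norm_sq_eq_re_im]
  simp
  ring

/-- Kernel vectors of `sheetMap` are spacelike for `c² - ‖p‖²`: otherwise the quadratic form
`ζ ↦ (Re (ζ̄ e))² - m ‖ζ‖² / 4` would not be positive at `ζ = e`. -/
lemma kernel_sheetMap_spacelike {d e z : ℂ} {C : Matrix (Fin r) (Fin s) ℂ}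
    {D : Matrix (Fin s) (Fin r) ℂ} (hDC : D * C = z • (1 : Matrix (Fin s) (Fin s) ℂ))
    (he : e ^ 2 = d ^ 2 + z) {h n m : ℝ} (hn : 0 < n) (hm0 : 0 < m)
    (hm : m = h + 2 * ‖e‖ ^ 2 - 2 * ‖d‖ ^ 2) (hnm : n + m = 4 * ‖e‖ ^ 2)
    (hpos : ∀ ζ : ℂ, 0 ≤ h * ‖ζ‖ ^ 2 - 2 * rdot (ζ ^ 2) z) {q : Fin s → ℂ} (hq : normSqVec q = 1)
    (hqh : star q ⬝ᵥ ((Cᴴ * C + D * Dᴴ) *ᵥ q) = (h : ℂ)) {x : ℝ × (Fin r → ℂ)} (hx : x ≠ 0)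
    (hker : sheetMap d C D q x = 0) : x.1 ^ 2 < normSqVec x.2 := by
  obtain ⟨c, p⟩ := x
  by_contra! hle
  rw [sheetMap_apply] at hker
  have hc : 0 < c ^ 2 := by
    refine lt_of_le_of_ne (sq_nonneg c) fun h0 => hx ?_
    have hc0 : c = 0 := by simpa using h0.symm
    have hp0 : p = 0 := normSqVec_eq_zero
      (le_antisymm (by simpa [hc0] using hle) (normSqVec_nonneg p))
    rw [hc0, hp0]
    rfl
  have h1 := rdot_crossTerm_sq_le hDC hqh p e
  rw [hq, mul_one] at h1
  have h2 : rdot e (crossTerm C D p q) = -2 * c * rdot e d := by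
    have : crossTerm C D p q = (-2 * c : ℝ) * d := by
      push_cast
      linear_combination 2 * hker
    rw [this]
    simp only [rdot, re_ofReal_mul, im_ofReal_mul]
    ring
  rw [h2] at h1
  have h3 := mul_le_mul_of_nonneg_right hle (hpos e)
  have h4 : c ^ 2 * (rdot e e ^ 2 - m / 4 * ‖e‖ ^ 2) ≤ 0 := by
    have := support_eq he hm e
    rw [this] at h1 h3
    linarith
  have h5 : rdot e e = ‖e‖ ^ 2 := by
    rw [norm_sq_eq_re_im, rdot]; ring
  have h6 : 0 < ‖e‖ ^ 2 * (n / 4) := by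
    have : 0 < ‖e‖ ^ 2 := by linarith
    positivity
  have h7 : rdot e e ^ 2 - m / 4 * ‖e‖ ^ 2 = ‖e‖ ^ 2 * (n / 4) := by
    rw [h5]
    linear_combination (-‖e‖ ^ 2 / 4) * hnm
  rw [h7] at h4
  exact absurd h4 (not_le.2 (mul_pos hc h6))

/-- Every point of the region bounded by the conic has a preimage with `c² - ‖p‖² ≥ 1`, namely the
point of the fibre that is critical for `c² - ‖p‖²`. -/
lemma exists_sheetMap_eq {d e z : ℂ} {C : Matrix (Fin r) (Fin s) ℂ}
    {D : Matrix (Fin s) (Fin r) ℂ} (hDC : D * C = z • (1 : Matrix (Fin s) (Fin s) ℂ))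
    (he : e ^ 2 = d ^ 2 + z) {h n m : ℝ} (hn : 0 < n) (hm0 : 0 < m)
    (hm : m = h + 2 * ‖e‖ ^ 2 - 2 * ‖d‖ ^ 2) (hnm : n + m = 4 * ‖e‖ ^ 2)
    {q : Fin s → ℂ} (hq : normSqVec q = 1)
    (hqh : star q ⬝ᵥ ((Cᴴ * C + D * Dᴴ) *ᵥ q) = (h : ℂ)) {Z : ℂ}
    (hZ : n * m ≤ conicForm e m Z) :
    ∃ (c : ℝ) (p : Fin r → ℂ), sheetMap d C D q (c, p) = Z ∧ 1 ≤ c ^ 2 - normSqVec p := by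
  set κ : ℝ := (2 * ‖d‖ ^ 2 - h) / 4 with hκ
  -- `ζ` solves `κ ζ + (e² / 2) ζ̄ = Z`, where the left side is `sheetMap` composed with its
  -- adjoint for the indefinite form
  set ζ : ℂ := ((-16 / (n * m) : ℝ) : ℂ) * (κ * Z - e ^ 2 / 2 * star Z) with hζ
  have hnm0 : n * m ≠ 0 := (mul_pos hn hm0).ne'
  have hκ' : κ = ‖e‖ ^ 2 / 2 - m / 4 := by rw [hκ, hm]; ring
  have hee (w : ℂ) : w * star w = ((‖w‖ ^ 2 : ℝ) : ℂ) := by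
    simpa using Complex.mul_conj' w
  have hdet : κ ^ 2 - ‖e‖ ^ 4 / 4 = -(n * m) / 16 := by
    rw [hκ']
    have : n = 4 * ‖e‖ ^ 2 - m := by linarith
    rw [this]; ring
  have hB : (κ : ℂ) * ζ + e ^ 2 / 2 * star ζ = Z := by
    have hs : star ζ = ((-16 / (n * m) : ℝ) : ℂ) * (κ * star Z - star e ^ 2 / 2 * Z) := by
      rw [hζ]
      simp
    have hdetC : (κ : ℂ) ^ 2 - e ^ 2 * star e ^ 2 / 4 = ((-(n * m) / 16 : ℝ) : ℂ) := by
      rw [← hdet, ← mul_pow, hee]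
      push_cast
      ring
    have hk : ((-16 / (n * m) : ℝ) : ℂ) * ((-(n * m) / 16 : ℝ) : ℂ) = 1 := by
      rw [← Complex.ofReal_mul, ← Complex.ofReal_one]
      congr 1
      field_simp
    rw [hs, hζ]
    linear_combination ((-16 / (n * m) : ℝ) : ℂ) * Z * hdetC + Z * hk
  refine ⟨rdot ζ d, ((-1 / 2 : ℝ) : ℂ) • supportVec C D q ζ, ?_, ?_⟩
  · rw [sheetMap_apply, crossTerm_smul_left, crossTerm_supportVec hDC, hqh, hq]
    have hrd : ((rdot ζ d : ℝ) : ℂ) = (star d * ζ + d * star ζ) / 2 := by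
      apply Complex.ext <;> simp [rdot] <;> ring
    have hκC : (κ : ℂ) = (2 * (d * star d) - h) / 4 := by
      rw [hee, hκ]; push_cast; ring
    have hz : z = e ^ 2 - d ^ 2 := by rw [he]; ring
    rw [hrd, ← hB, hκC, hz]
    push_cast
    ring
  · rw [normSqVec_smul, normSqVec_supportVec hDC hqh, hq, mul_one, support_eq he hm,
      Complex.norm_real, Real.norm_eq_abs, sq_abs]
    have h1 : rdot ζ d ^ 2 - (-1 / 2) ^ 2 * (4 * (rdot ζ d ^ 2 - (rdot ζ e ^ 2 - m / 4 * ‖ζ‖ ^ 2)))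
        = rdot ζ Z := by
      rw [← hB, norm_sq_eq_re_im, hκ', norm_sq_eq_re_im]
      simp [rdot, pow_two]
      ring
    have h2 : rdot ζ Z = conicForm e m Z / (n * m) := by
      have : rdot ζ Z = -16 / (n * m) * rdot (κ * Z - e ^ 2 / 2 * star Z) Z := by
        rw [hζ]
        simp only [rdot, re_ofReal_mul, im_ofReal_mul]
        ring
      have hre : rdot (κ * Z - e ^ 2 / 2 * star Z) Z = κ * (Z.re ^ 2 + Z.im ^ 2) -
          ((e.re ^ 2 - e.im ^ 2) * (Z.re ^ 2 - Z.im ^ 2) + 4 * e.re * e.im * Z.re * Z.im) / 2 := by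
        simp [rdot, pow_two]
        ring
      rw [this, conicForm, hre, hκ', norm_sq_eq_re_im]
      field_simp
      ring
    rw [h1, h2, one_le_div (mul_pos hn hm0)]
    exact hZ

lemma mem_numRange_of_le_conicForm (hr : 0 < r) {g d e z : ℂ} {C : Matrix (Fin r) (Fin s) ℂ}
    {D : Matrix (Fin s) (Fin r) ℂ} (hDC : D * C = z • (1 : Matrix (Fin s) (Fin s) ℂ))
    (he : e ^ 2 = d ^ 2 + z) {h n m : ℝ} (hn : 0 < n) (hm0 : 0 < m)
    (hm : m = h + 2 * ‖e‖ ^ 2 - 2 * ‖d‖ ^ 2) (hnm : n + m = 4 * ‖e‖ ^ 2)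
    (hpos : ∀ ζ : ℂ, 0 ≤ h * ‖ζ‖ ^ 2 - 2 * rdot (ζ ^ 2) z) {q : Fin s → ℂ} (hq : normSqVec q = 1)
    (hqh : star q ⬝ᵥ ((Cᴴ * C + D * Dᴴ) *ᵥ q) = (h : ℂ)) {w : ℂ}
    (hw : n * m ≤ conicForm e m (w - g)) :
    w ∈ numRange (inertia r s) (blockMatrix (g + d) (g - d) C D) := by
  obtain ⟨c, p, hcp, h1⟩ := exists_sheetMap_eq hDC he hn hm0 hm hnm hq hqh hw
  obtain ⟨⟨c', p'⟩, hx0, hker⟩ := exists_kernel_sheetMap hr d C D q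
  have hspace := kernel_sheetMap_spacelike hDC he hn hm0 hm hnm hpos hq hqh hx0 hker
  obtain ⟨b, hb⟩ := exists_normSqVec_add_smul p p'
  obtain ⟨t, ht⟩ := exists_quadratic_eq_one (a := c' ^ 2 - normSqVec p') (b := 2 * c * c' - b)
    (c := c ^ 2 - normSqVec p) (sub_neg.2 hspace) h1
  refine mem_numRange_of_sheetMap hr g d C D hq (c := c + t * c') (p := p + t • p') ?_ ?_
  · rw [hb]
    linear_combination ht
  · have : ((c + t * c', p + t • p') : ℝ × (Fin r → ℂ)) = (c, p) + t • (c', p') := rfl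
    rw [this, map_add, map_smul, hker, hcp, smul_zero, add_zero]

lemma numRange_eq_hyperbolicDisc (hr : 0 < r) {g d e z : ℂ} {C : Matrix (Fin r) (Fin s) ℂ}
    {D : Matrix (Fin s) (Fin r) ℂ} (hDC : D * C = z • (1 : Matrix (Fin s) (Fin s) ℂ))
    (he : e ^ 2 = d ^ 2 + z) {h n m : ℝ} (hn : 0 < n) (hm0 : 0 < m)
    (hm : m = h + 2 * ‖e‖ ^ 2 - 2 * ‖d‖ ^ 2) (hnm : n + m = 4 * ‖e‖ ^ 2)
    (hle : ∀ q : Fin s → ℂ, ∃ η : ℝ, star q ⬝ᵥ ((Cᴴ * C + D * Dᴴ) *ᵥ q) = η ∧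
      η ≤ h * normSqVec q)
    (hpos : ∀ ζ : ℂ, 0 ≤ h * ‖ζ‖ ^ 2 - 2 * rdot (ζ ^ 2) z) {q : Fin s → ℂ} (hq : normSqVec q = 1)
    (hqh : star q ⬝ᵥ ((Cᴴ * C + D * Dᴴ) *ᵥ q) = (h : ℂ)) :
    numRange (inertia r s) (blockMatrix (g + d) (g - d) C D) =
      hyperbolicDisc (g + e) (g - e) (√n) := by
  ext w
  rw [mem_hyperbolicDisc_iff g e w hm0 hnm]
  exact ⟨le_conicForm_of_mem_numRange hDC he hm hnm hle hpos,
    mem_numRange_of_le_conicForm hr hDC he hn hm0 hm hnm hpos hq hqh⟩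

end KreinRange

namespace KreinRange

/-! ### The components of the indefinite Kippenhahn curve -/

open MvPolynomial in
lemma conicPoly_zero (g e : ℂ) : conicPoly g e 0 = pointForm (g + e) * pointForm (g - e) := by
  simp [conicPoly]

/-- The irreducible factors of a product of point and conic forms, read as curves. -/
lemma exists_irreducible_factor_iff {ι : Type*} [Fintype ι] (k : ℕ) (α g e : ℂ) {n m : ι → ℝ}
    (hn : ∀ j, 0 < n j) (hm : ∀ j, 0 ≤ m j) (hnm : ∀ j, n j + m j = 4 * ‖e‖ ^ 2) (K : Set ℂ) :
    (∃ q : MvPolynomial (Fin 3) ℂ, Irreducible q ∧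
        q ∣ pointForm α ^ k * ∏ j, conicPoly g e (m j) ∧ K = realAffinePart (dualCurve q)) ↔
      (∃ j, 0 < m j ∧ K = hyperbola (g + e) (g - e) (√(n j))) ∨
        (∃ j, m j = 0 ∧ (K = {g + e} ∨ K = {g - e})) ∨ (0 < k ∧ K = {α}) := by
  have hirr := irreducible_pointForm
  constructor
  · rintro ⟨q, hq, hdvd, rfl⟩
    have eq_singleton {f : ℂ} (h : q ∣ pointForm f) : realAffinePart (dualCurve q) = {f} := by
      rw [dualCurve_eq_of_associated (hq.associated_of_dvd (hirr f) h),
        realAffinePart_dualCurve_pointForm]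
    rcases hq.prime.dvd_or_dvd hdvd with h | h
    · right; right
      refine ⟨Nat.pos_of_ne_zero ?_, eq_singleton (hq.prime.dvd_of_dvd_pow h)⟩
      rintro rfl
      exact hq.not_isUnit (isUnit_of_dvd_one (by simpa using h))
    · obtain ⟨j, -, hj⟩ := hq.prime.exists_mem_finset_dvd h
      rcases (hm j).eq_or_lt with h0 | h0
      · right; left
        rw [← h0, conicPoly_zero] at hj
        exact ⟨j, h0.symm, (hq.prime.dvd_or_dvd hj).imp eq_singleton eq_singleton⟩
      · left
        refine ⟨j, h0, ?_⟩
        rw [dualCurve_eq_of_associated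
            (hq.associated_of_dvd (irreducible_conicPoly g e (hn j) h0 (hnm j)) hj),
          realAffinePart_dualCurve_conicPoly g e (hn j) h0 (hnm j)]
  · have hfac (j : ι) : conicPoly g e (m j) ∣ pointForm α ^ k * ∏ j, conicPoly g e (m j) :=
      (Finset.dvd_prod_of_mem _ (Finset.mem_univ j)).mul_left _
    rintro (⟨j, h0, rfl⟩ | ⟨j, h0, rfl | rfl⟩ | ⟨h0, rfl⟩)
    · exact ⟨_, irreducible_conicPoly g e (hn j) h0 (hnm j), hfac j,
        (realAffinePart_dualCurve_conicPoly g e (hn j) h0 (hnm j)).symm⟩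
    · have := hfac j
      rw [h0, conicPoly_zero] at this
      exact ⟨_, hirr _, (dvd_mul_right _ _).trans this,
        (realAffinePart_dualCurve_pointForm _).symm⟩
    · have := hfac j
      rw [h0, conicPoly_zero] at this
      exact ⟨_, hirr _, (dvd_mul_left _ _).trans this,
        (realAffinePart_dualCurve_pointForm _).symm⟩
    · exact ⟨_, hirr _, (dvd_pow_self _ h0.ne').mul_right _,
        (realAffinePart_dualCurve_pointForm _).symm⟩

lemma nested_of_common_foci (F₁ F₂ : ℂ) (N N' : ℝ) : Nested F₁ F₂ N F₁ F₂ N' :=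
  (le_total N' N).imp (fun h _ hw => h.trans hw) (fun h _ hw => h.trans hw)

end KreinRange

open KreinRange in
theorem mainTheorem5 {r s : ℕ} (hsr : s ≤ r) (α β z₁ : ℂ) (hαβ : α ≠ β)
    (C : Matrix (Fin r) (Fin s) ℂ) (D : Matrix (Fin s) (Fin r) ℂ)
    (hCD : C ≠ 0 ∨ D ≠ 0)
    (hDC : D * C = z₁ • (1 : Matrix (Fin s) (Fin s) ℂ))
    -- `h j` are the eigenvalues of `C^*C + DD^*`, and `h j₁` is the largest one
    (U : Matrix (Fin s) (Fin s) ℂ) (hU : U ∈ Matrix.unitaryGroup (Fin s) ℂ)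
    (h : Fin s → ℝ)
    (hdiag : Uᴴ * (Cᴴ * C + D * Dᴴ) * U = Matrix.diagonal (fun j => (h j : ℂ)))
    (j₁ : Fin s) (hj₁ : ∀ j, h j ≤ h j₁)
    -- the common foci are `(α + β) / 2 ± δ / 2` with `δ` a square root of `(α - β)² + 4 z₁`
    (δ : ℂ) (hδ : δ ^ 2 = (α - β) ^ 2 + 4 * z₁)
    (fp fm : ℂ) (hfp : fp = (α + β) / 2 + δ / 2) (hfm : fm = (α + β) / 2 - δ / 2) :
    (KreinRange.IsNondegenerateHyperbolicDisc
        (KreinRange.numRange (KreinRange.inertia r s) (KreinRange.blockMatrix α β C D))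
        fp fm (KreinRange.nonTransverseAxis α β z₁ (h j₁)) ↔
      |‖α - β‖ ^ 2 - 2 * KreinRange.euclideanOpNorm (Cᴴ * C + D * Dᴴ)| <
        ‖(α - β) ^ 2 + 4 * z₁‖) ∧
    (|‖α - β‖ ^ 2 - 2 * KreinRange.euclideanOpNorm (Cᴴ * C + D * Dᴴ)| <
        ‖(α - β) ^ 2 + 4 * z₁‖ →
      -- the components of the indefinite Kippenhahn curve: the hyperbolas of the family (each
      -- reduced to its two foci where its non-transverse axis is zero), and `α` when `n < 2r`
      (∀ K : Set ℂ,
        K ∈ KreinRange.kippenhahnComponents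
            (KreinRange.inertia r s) (KreinRange.blockMatrix α β C D) ↔
          (∃ j, 0 < KreinRange.nonTransverseAxis α β z₁ (h j) ∧
              K = KreinRange.hyperbola fp fm (KreinRange.transverseAxis α β z₁ (h j))) ∨
          (∃ j, KreinRange.nonTransverseAxis α β z₁ (h j) = 0 ∧ (K = {fp} ∨ K = {fm})) ∨
          (s < r ∧ K = {α})) ∧
      (∀ j, 0 < KreinRange.transverseAxis α β z₁ (h j) ∧
        KreinRange.transverseAxis α β z₁ (h j) ^ 2
          + KreinRange.nonTransverseAxis α β z₁ (h j) ^ 2 = ‖fp - fm‖ ^ 2) ∧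
      (∀ j k, KreinRange.Nested fp fm (KreinRange.transverseAxis α β z₁ (h j))
        fp fm (KreinRange.transverseAxis α β z₁ (h k)))) := by
  obtain ⟨g, hg⟩ : ∃ g, g = (α + β) / 2 := ⟨_, rfl⟩
  obtain ⟨d, hd⟩ : ∃ d, d = (α - β) / 2 := ⟨_, rfl⟩
  obtain ⟨e, he⟩ : ∃ e, e = δ / 2 := ⟨_, rfl⟩
  have hα : α = g + d := by rw [hg, hd]; ring
  have hβ : β = g - d := by rw [hg, hd]; ring
  rw [← hg, ← he] at hfp hfm
  have hδe : δ = 2 * e := by rw [he]; ring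
  have hαd : α - β = 2 * d := by rw [hd]; ring
  have hed : e ^ 2 = d ^ 2 + z₁ := by
    rw [hδe, hαd] at hδ
    linear_combination hδ / 4
  have hnormΔ : ‖(α - β) ^ 2 + 4 * z₁‖ = 4 * ‖e‖ ^ 2 := by
    rw [← hδ, hδe, norm_pow, norm_mul, Complex.norm_two]; ring
  have hnormd : ‖α - β‖ ^ 2 = 4 * ‖d‖ ^ 2 := by
    rw [hαd, norm_mul, Complex.norm_two]; ring
  have hfoci : ‖fp - fm‖ ^ 2 = 4 * ‖e‖ ^ 2 := by
    rw [hfp, hfm, show g + e - (g - e) = 2 * e by ring, norm_mul, Complex.norm_two]; ring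
  have hN (j : Fin s) : transverseAxis α β z₁ (h j) = √(2 * ‖e‖ ^ 2 + 2 * ‖d‖ ^ 2 - h j) := by
    rw [transverseAxis, hnormΔ, hnormd]; congr 1; ring
  have hM (j : Fin s) : nonTransverseAxis α β z₁ (h j) =
      √(h j + 2 * ‖e‖ ^ 2 - 2 * ‖d‖ ^ 2) := by
    rw [nonTransverseAxis, hnormΔ, hnormd]; congr 1; ring
  have hsum (j : Fin s) : (2 * ‖e‖ ^ 2 + 2 * ‖d‖ ^ 2 - h j) + (h j + 2 * ‖e‖ ^ 2 - 2 * ‖d‖ ^ 2) =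
      4 * ‖e‖ ^ 2 := by ring
  have hsupp (j : Fin s) (ζ : ℂ) : 0 ≤ h j * ‖ζ‖ ^ 2 - 2 * rdot (ζ ^ 2) z₁ := by
    obtain ⟨q, hq, hqh⟩ := exists_unit_eigenvector hU hdiag j
    have := normSqVec_supportVec hDC hqh ζ
    rw [hq, mul_one] at this
    rw [← this]
    exact normSqVec_nonneg _
  have hh0 (j : Fin s) : 0 ≤ h j := by
    have h1 := hsupp j 1
    have h2 := hsupp j Complex.I
    simp [rdot] at h1 h2
    linarith
  rw [euclideanOpNorm_eq hU hdiag hj₁ hh0, hnormΔ, hnormd, abs_lt]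
  have hm0 (j : Fin s) : 0 ≤ h j + 2 * ‖e‖ ^ 2 - 2 * ‖d‖ ^ 2 := by
    -- at `ζ = i d`, orthogonal to `d`, only the term with the non-transverse axis is non-negative
    have h1 := hsupp j (Complex.I * d)
    have h2 : rdot (Complex.I * d) d = 0 := by simp [rdot]; ring
    rw [support_eq hed rfl, h2, norm_mul, Complex.norm_I, one_mul] at h1
    have hd0 : 0 < ‖d‖ ^ 2 := by
      have : d ≠ 0 := by
        rintro rfl
        exact hαβ (by linear_combination hαd)
      positivity
    refine nonneg_of_mul_nonneg_left (b := ‖d‖ ^ 2) ?_ hd0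
    nlinarith [sq_nonneg (rdot (Complex.I * d) e)]
  refine ⟨⟨?_, fun hcond => ?_⟩, fun hcond => ⟨fun K => ?_, fun j => ?_, fun j k =>
    nested_of_common_foci _ _ _ _⟩⟩
  · rintro ⟨hMpos, N, hNpos, hNM, -⟩
    rw [hM, Real.sqrt_pos] at hMpos
    rw [hM, Real.sq_sqrt hMpos.le, hfoci] at hNM
    have := pow_pos hNpos 2
    constructor <;> linarith
  · have hn : 0 < 2 * ‖e‖ ^ 2 + 2 * ‖d‖ ^ 2 - h j₁ := by linarith
    have hm : 0 < h j₁ + 2 * ‖e‖ ^ 2 - 2 * ‖d‖ ^ 2 := by linarith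
    rw [hM]
    refine ⟨Real.sqrt_pos.2 hm, √(2 * ‖e‖ ^ 2 + 2 * ‖d‖ ^ 2 - h j₁), Real.sqrt_pos.2 hn, ?_, ?_⟩
    · rw [Real.sq_sqrt hn.le, Real.sq_sqrt hm.le, hfoci, hsum]
    · obtain ⟨q, hq, hqh⟩ := exists_unit_eigenvector hU hdiag j₁
      rw [hα, hβ, hfp, hfm]
      exact numRange_eq_hyperbolicDisc (by have := j₁.isLt; omega) hDC hed hn hm rfl (hsum j₁)
        (exists_quadratic_apply_le hU hdiag hj₁) (hsupp j₁) hq hqh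
  · have hn (j : Fin s) : 0 < 2 * ‖e‖ ^ 2 + 2 * ‖d‖ ^ 2 - h j := by linarith [hj₁ j]
    have hpoly : kippenhahnPoly (inertia r s) (blockMatrix α β C D) =
        pointForm α ^ (r - s) * ∏ j, conicPoly g e (h j + 2 * ‖e‖ ^ 2 - 2 * ‖d‖ ^ 2) := by
      rw [kippenhahnPoly_eq hsr α β z₁ hDC hU hdiag]
      congr 1
      refine Finset.prod_congr rfl fun j _ => ?_
      rw [hα, hβ]
      exact conicPoly_eq hed rfl
    have := exists_irreducible_factor_iff (r - s) α g e hn hm0 hsum K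
    rw [← hpoly] at this
    simp only [hM, hN, Real.sqrt_pos, Real.sqrt_eq_zero (hm0 _), hfp, hfm]
    rw [← Nat.sub_pos_iff_lt]
    exact this
  · have hn : 0 < 2 * ‖e‖ ^ 2 + 2 * ‖d‖ ^ 2 - h j := by linarith [hj₁ j]
    rw [hM, hN, Real.sq_sqrt hn.le, Real.sq_sqrt (hm0 j), hfoci, hsum]
    exact ⟨Real.sqrt_pos.2 hn, rfl⟩
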